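/- Let $T,d\in\mathbb N$, let $\Omega_1,\dots,\Omega_T$ be Polish spaces, $\Omega^t:=\Omega_1\times\dots\times\Omega_t$ ($\Omega^0$ a singleton), and write $\omega^{t+1}=(\omega^t,\omega_{t+1})$. Let $\mathfrak P(X)$ be the set of Borel probability measures on $X$ (with the weak topology), $\mathcal B(X)$ the Borel $\sigma$-algebra and $\mathcal B_c(X)$ the universal $\sigma$-algebra, i.e. the intersection of the completions of $\mathcal B(X)$ under all $P\in\mathfrak P(X)$. Let $S_t:\Omega^t\to\mathbb R^d$ be $\mathcal B(\Omega^t)$-measurable for $0\le t\le T$, and $\Delta S_{t+1}:=S_{t+1}-S_t$. For $0\le t\le T-1$ and $\omega^t\in\Omega^t$ let $\mathcal Q_{t+1}(\omega^t)\subset\mathfrak P(\Omega_{t+1})$ be non-empty and convex, such that $\{(\omega^t,p):p\in\mathcal Q_{t+1}(\omega^t)\}$ is an analytic subset of $\Omega^t\times\mathfrak P(\Omega_{t+1})$. Let $\mathcal Q^0$ consist of the unique probability measure on $\Omega^0$ and let $\mathcal Q^{t+1}$ be the set of all products $P\otimes q$ with $P\in\mathcal Q^t$ and $q$ a universally measurable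 stochastic kernel on $\Omega_{t+1}$ given $\Omega^t$ with $q(\cdot,\omega^t)\in\mathcal Q_{t+1}(\omega^t)$ for all $\omega^t$. A set is $\mathcal Q^t$-polar if it is contained in a $P$-null set for each $P\in\mathcal Q^t$; it is of $\mathcal Q^t$-full measure if its complement is $\mathcal Q^t$-polar; a property holds $\mathcal Q^t$-q.s. if it holds outside a $\mathcal Q^t$-polar set. Let $D^{t+1}(\omega^t)$ be the intersection of all closed $A\subset\mathbb R^d$ such that $p(\Delta S_{t+1}(\omega^t,\cdot)\in A)=1$ for all $p\in\mathcal Q_{t+1}(\omega^t)$. $\mathrm{Conv}$, $\mathrm{Aff}$ and $\mathrm{Ri}$ denote convex hull, affine hull and relative interior, $|\cdot|$ is the Euclidean norm, $hy$ the scalar product of $h,y\in\mathbb R^d$, and $B(0,\varepsilon)$ the open Euclidean ball. For $0\le t\le T-1$ consider the following conditions at $\omega^t\in\Omega^t$: * $(G)$: $0\in\mathrm{Ri}(\mathrm{Conv}(D^{t+1}(\omega^t)))$; * $(Q)$: there are $\beta,\kappa\in(0,1)$ such that for every $h\in\mathrm{Aff}(D^{t+1}(\omega^t))$, $h\ne0$,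 there is $p_h\in\mathcal Q_{t+1}(\omega^t)$ with $p_h\big(h\Delta S_{t+1}(\omega^t,\cdot)<-\beta|h|\big)\ge\kappa$. Assume that one of the following three no-arbitrage conditions holds: 1. ($NA(\mathcal Q^T)$) for all $\mathcal B_c(\Omega^{t-1})$-measurable $\phi_t:\Omega^{t-1}\to\mathbb R^d$, $1\le t\le T$, if $\sum_{t=1}^T\phi_t\Delta S_t\ge0$ $\mathcal Q^T$-q.s., then $\sum_{t=1}^T\phi_t\Delta S_t=0$ $\mathcal Q^T$-q.s.; 2. (geometric no-arbitrage) for all $0\le t\le T-1$ there is a $\mathcal Q^t$-full measure set $A\in\mathcal B_c(\Omega^t)$ such that $(G)$ holds at every $\omega^t\in A$; 3. (quantitative no-arbitrage) for all $0\le t\le T-1$ there is a $\mathcal Q^t$-full measure set $A\in\mathcal B_c(\Omega^t)$ such that $(Q)$ holds at every $\omega^t\in A$. Then, for every $0\le t\le T-1$: * the set $\{\omega^t:(G)\text{ holds at }\omega^t\}$ belongs to $\mathcal B_c(\Omega^t)$ and is of $\mathcal Q^t$-full measure, and there is a $\mathcal B_c(\Omega^t)$-measurable function $\varepsilon_t:\Omega^t\to\mathbb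 R$ such that for every $\omega^t$ in this set $\varepsilon_t(\omega^t)>0$ and $$B(0,\varepsilon_t(\omega^t))\cap\mathrm{Aff}(D^{t+1}(\omega^t))\subset\mathrm{Conv}(D^{t+1}(\omega^t));$$ * the set $\{\omega^t:(Q)\text{ holds at }\omega^t\}$ belongs to $\mathcal B_c(\Omega^t)$ and is of $\mathcal Q^t$-full measure, and there is a $\mathcal B_c(\Omega^t)$-measurable function $\beta_t:\Omega^t\to\mathbb R$ such that for every $\omega^t$ in this set $\beta_t(\omega^t)\in(0,1)$ and there is $\kappa_t(\omega^t)\in(0,1)$ such that for every $h\in\mathrm{Aff}(D^{t+1}(\omega^t))$, $h\neq0$, there is $p_h\in\mathcal Q_{t+1}(\omega^t)$ with $$p_h\big(h\Delta S_{t+1}(\omega^t,\cdot)<-\beta_t(\omega^t)|h|\big)\ge\kappa_t(\omega^t).$$ -/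

import Mathlib

open MeasureTheory

namespace QuasiSure

universe u

/-- `Hist Ω t` is the space of histories up to time `t`: a singleton for `t = 0`, and
`Hist Ω (t + 1) = Hist Ω t × Ω t`. The space `Ω t` carries the scenarios of the period between
the times `t` and `t + 1`. -/
def Hist (Ω : ℕ → Type u) : ℕ → Type u
  | 0 => PUnit
  | t + 1 => Hist Ω t × Ω t

instance Hist.instTopologicalSpace (Ω : ℕ → Type u) [∀ t, TopologicalSpace (Ω t)] :
    ∀ t, TopologicalSpace (Hist Ω t)
  | 0 => inferInstanceAs (TopologicalSpace PUnit)
  | t + 1 =>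
    letI := Hist.instTopologicalSpace Ω t
    inferInstanceAs (TopologicalSpace (Hist Ω t × Ω t))

/-- The product sigma-algebra; for Polish factors with their Borel sigma-algebras this is the
Borel sigma-algebra of the product topology. -/
instance Hist.instMeasurableSpace (Ω : ℕ → Type u) [∀ t, MeasurableSpace (Ω t)] :
    ∀ t, MeasurableSpace (Hist Ω t)
  | 0 => inferInstanceAs (MeasurableSpace PUnit)
  | t + 1 =>
    letI := Hist.instMeasurableSpace Ω t
    inferInstanceAs (MeasurableSpace (Hist Ω t × Ω t))

/-- The concatenation `(ω, w)` of a history `ω` up to time `t` and a scenario `w` of the next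
period. -/
def Hist.snoc {Ω : ℕ → Type u} {t : ℕ} (ω : Hist Ω t) (w : Ω t) : Hist Ω (t + 1) := (ω, w)

/-- The universal sigma-algebra: the intersection, over all probability measures `μ`, of the
`μ`-completions of the given sigma-algebra (`NullMeasurableSet s μ` says that `s` belongs to
the completion for `μ`). -/
@[reducible] def universalSigma (X : Type*) [MeasurableSpace X] : MeasurableSpace X where
  MeasurableSet' s := ∀ μ : ProbabilityMeasure X, NullMeasurableSet s (μ : Measure X)
  measurableSet_empty _ := MeasurableSet.empty.nullMeasurableSet
  measurableSet_compl _ hs μ := (hs μ).compl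
  measurableSet_iUnion _ hf μ := NullMeasurableSet.iUnion fun i => hf i μ

/-- Universally measurable sets. -/
def UnivMeasurableSet {X : Type*} [MeasurableSpace X] (s : Set X) : Prop :=
  MeasurableSet[universalSigma X] s

/-- Universally measurable functions. -/
def UnivMeasurable {X Y : Type*} [MeasurableSpace X] [MeasurableSpace Y] (f : X → Y) : Prop :=
  Measurable[universalSigma X] f

/-- `N` is polar for `𝔐`: it is a null set of (the completion of) every `P ∈ 𝔐`. The value `P N`
is the outer measure, so that `P N = 0` says that `N` is contained in a `P`-null set. -/
def IsPolar {X : Type*} [MeasurableSpace X] (𝔐 : Set (ProbabilityMeasure X)) (N : Set X) : Prop :=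
  ∀ P ∈ 𝔐, (P : Measure X) N = 0

/-- `A` is of `𝔐`-full measure: its complement is polar. -/
def IsFull {X : Type*} [MeasurableSpace X] (𝔐 : Set (ProbabilityMeasure X)) (A : Set X) : Prop :=
  IsPolar 𝔐 Aᶜ

/-- The property `p` holds `𝔐`-quasi-surely: outside a polar set. -/
def QS {X : Type*} [MeasurableSpace X] (𝔐 : Set (ProbabilityMeasure X)) (p : X → Prop) : Prop :=
  IsPolar 𝔐 {x | ¬ p x}

section Prices

variable {Ω : ℕ → Type u} {d : ℕ}

/-- The price increment `ΔS` between `t` and `t + 1`, given the history `ω` up to `t`, as a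
function of the scenario `w` of that period. -/
def increment (S : (t : ℕ) → Hist Ω t → EuclideanSpace ℝ (Fin d)) (t : ℕ) (ω : Hist Ω t)
    (w : Ω t) : EuclideanSpace ℝ (Fin d) :=
  S (t + 1) (ω.snoc w) - S t ω

/-- The value at time `t` of the self-financing portfolio with initial capital `0` and strategy
`φ`, where `φ t` are the holdings during the period between `t` and `t + 1`. -/
noncomputable def portfolioValue (S φ : (t : ℕ) → Hist Ω t → EuclideanSpace ℝ (Fin d)) :
    (t : ℕ) → Hist Ω t → ℝ
  | 0, _ => 0
  | t + 1, ω => portfolioValue S φ t ω.1 + inner ℝ (φ t ω.1) (increment S t ω.1 ω.2)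

end Prices

section Model

variable {Ω : ℕ → Type u}

/-- The assumption on the sets of one-period priors up to the horizon `T`: `Q t ω` (the set of
priors for the period between `t` and `t + 1`, given the history `ω`) is non-empty and convex,
and the graph of `Q t` is an analytic set. -/
structure PriorAssumption [∀ t, TopologicalSpace (Ω t)] [∀ t, MeasurableSpace (Ω t)]
    [∀ t, BorelSpace (Ω t)] (T : ℕ)
    (Q : (t : ℕ) → Hist Ω t → Set (ProbabilityMeasure (Ω t))) : Prop where
  nonempty : ∀ t < T, ∀ ω, (Q t ω).Nonempty
  convex : ∀ t < T, ∀ ω, ∀ p ∈ Q t ω, ∀ q ∈ Q t ω, ∀ a b : NNReal, a + b = 1 →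
    ∀ r : ProbabilityMeasure (Ω t),
      (r : Measure (Ω t)) = a • (p : Measure (Ω t)) + b • (q : Measure (Ω t)) → r ∈ Q t ω
  analytic : ∀ t < T,
    AnalyticSet {x : Hist Ω t × ProbabilityMeasure (Ω t) | x.2 ∈ Q t x.1}

variable [∀ t, MeasurableSpace (Ω t)]

/-- A universally measurable stochastic kernel on `Ω t` given `Hist Ω t`: for every Borel set `B`,
the map `ω ↦ q ω B` is universally measurable. -/
def IsUnivKernel {t : ℕ} (q : Hist Ω t → ProbabilityMeasure (Ω t)) : Prop :=
  ∀ B : Set (Ω t), MeasurableSet B → UnivMeasurable fun ω => (q ω : Measure (Ω t)) B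

/-- `P'` is the product `P ⊗ q` of a probability measure `P` on the histories up to `t` and a
universally measurable kernel `q`:
`P'(A) = ∫ q(ω)({w : (ω, w) ∈ A}) P(dω)` for all measurable `A`. -/
def IsKernelProduct {t : ℕ} (P : ProbabilityMeasure (Hist Ω t))
    (q : Hist Ω t → ProbabilityMeasure (Ω t)) (P' : ProbabilityMeasure (Hist Ω (t + 1))) : Prop :=
  ∀ A : Set (Hist Ω (t + 1)), MeasurableSet A →
    (P' : Measure (Hist Ω (t + 1))) A =
      ∫⁻ ω, (q ω : Measure (Ω t)) {w | Hist.snoc ω w ∈ A} ∂(P : Measure (Hist Ω t))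

/-- The set of all priors on the histories up to time `t`, that is, of all products
`q₁ ⊗ q₂ ⊗ ⋯ ⊗ q_t` of universally measurable kernels with values in the sets of one-period
priors. On the one-point space of histories up to time `0` there is just one probability
measure. -/
def priors (Q : (t : ℕ) → Hist Ω t → Set (ProbabilityMeasure (Ω t))) :
    (t : ℕ) → Set (ProbabilityMeasure (Hist Ω t))
  | 0 => Set.univ
  | t + 1 => {P' | ∃ P ∈ priors Q t, ∃ q : Hist Ω t → ProbabilityMeasure (Ω t),
      IsUnivKernel q ∧ (∀ ω, q ω ∈ Q t ω) ∧ IsKernelProduct P q P'}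

variable {d : ℕ}

/-- The price process is adapted to the Borel sigma-algebras, up to the horizon `T`. -/
def AdaptedPrices (T : ℕ) (S : (t : ℕ) → Hist Ω t → EuclideanSpace ℝ (Fin d)) : Prop :=
  ∀ t ≤ T, Measurable (S t)

/-- The quasi-sure no-arbitrage condition `NA(𝒬^T)`: for every universally measurable strategy
`φ`, if its terminal value is non-negative quasi-surely, then it vanishes quasi-surely. -/
def NoArbitrage (T : ℕ) (S : (t : ℕ) → Hist Ω t → EuclideanSpace ℝ (Fin d))
    (Q : (t : ℕ) → Hist Ω t → Set (ProbabilityMeasure (Ω t))) : Prop :=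
  ∀ φ : (t : ℕ) → Hist Ω t → EuclideanSpace ℝ (Fin d), (∀ t < T, UnivMeasurable (φ t)) →
    QS (priors Q T) (fun ω => 0 ≤ portfolioValue S φ T ω) →
    QS (priors Q T) (fun ω => portfolioValue S φ T ω = 0)

/-- The multiple-priors conditional support `D^{t+1}(ω)` of the price increment. -/
def condSupport (S : (t : ℕ) → Hist Ω t → EuclideanSpace ℝ (Fin d))
    (Q : (t : ℕ) → Hist Ω t → Set (ProbabilityMeasure (Ω t))) (t : ℕ) (ω : Hist Ω t) :
    Set (EuclideanSpace ℝ (Fin d)) :=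
  ⋂₀ {A | IsClosed A ∧ ∀ p ∈ Q t ω, (p : Measure (Ω t)) {w | increment S t ω w ∈ A} = 1}

/-- `Conv(D^{t+1})(ω)`. -/
def convSupport (S : (t : ℕ) → Hist Ω t → EuclideanSpace ℝ (Fin d))
    (Q : (t : ℕ) → Hist Ω t → Set (ProbabilityMeasure (Ω t))) (t : ℕ) (ω : Hist Ω t) :
    Set (EuclideanSpace ℝ (Fin d)) :=
  convexHull ℝ (condSupport S Q t ω)

/-- `Aff(D^{t+1})(ω)`. -/
def affSupport (S : (t : ℕ) → Hist Ω t → EuclideanSpace ℝ (Fin d))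
    (Q : (t : ℕ) → Hist Ω t → Set (ProbabilityMeasure (Ω t))) (t : ℕ) (ω : Hist Ω t) :
    Set (EuclideanSpace ℝ (Fin d)) :=
  affineSpan ℝ (condSupport S Q t ω)

/-- The geometric condition at the history `ω`: `0` lies in the relative interior of
`Conv(D^{t+1})(ω)`. -/
def GeomAt (S : (t : ℕ) → Hist Ω t → EuclideanSpace ℝ (Fin d))
    (Q : (t : ℕ) → Hist Ω t → Set (ProbabilityMeasure (Ω t))) (t : ℕ) (ω : Hist Ω t) : Prop :=
  0 ∈ intrinsicInterior ℝ (convSupport S Q t ω)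

/-- `ε > 0` is an admissible radius at `ω`: `B(0, ε) ∩ Aff(D^{t+1})(ω) ⊆ Conv(D^{t+1})(ω)`. -/
def IsRadius (S : (t : ℕ) → Hist Ω t → EuclideanSpace ℝ (Fin d))
    (Q : (t : ℕ) → Hist Ω t → Set (ProbabilityMeasure (Ω t))) (t : ℕ) (ω : Hist Ω t)
    (ε : ℝ) : Prop :=
  0 < ε ∧ Metric.ball 0 ε ∩ affSupport S Q t ω ⊆ convSupport S Q t ω

/-- `β ∈ (0, 1)` is an admissible loss size at `ω`: there is `κ ∈ (0, 1)` such that every nonzero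
`h ∈ Aff(D^{t+1})(ω)` admits a one-period prior `p` with `p(h ΔS < -β |h|) ≥ κ`. -/
def IsLossSize (S : (t : ℕ) → Hist Ω t → EuclideanSpace ℝ (Fin d))
    (Q : (t : ℕ) → Hist Ω t → Set (ProbabilityMeasure (Ω t))) (t : ℕ) (ω : Hist Ω t)
    (β : ℝ) : Prop :=
  β ∈ Set.Ioo (0 : ℝ) 1 ∧ ∃ κ ∈ Set.Ioo (0 : ℝ) 1, ∀ h ∈ affSupport S Q t ω, h ≠ 0 →
    ∃ p ∈ Q t ω, κ ≤ (p : Measure (Ω t)).real {w | inner ℝ h (increment S t ω w) < -β * ‖h‖}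

/-- The quantitative condition at the history `ω`. -/
def QuantAt (S : (t : ℕ) → Hist Ω t → EuclideanSpace ℝ (Fin d))
    (Q : (t : ℕ) → Hist Ω t → Set (ProbabilityMeasure (Ω t))) (t : ℕ) (ω : Hist Ω t) : Prop :=
  ∃ β : ℝ, IsLossSize S Q t ω β

/-- The geometric no-arbitrage condition. -/
def GeometricNA (T : ℕ) (S : (t : ℕ) → Hist Ω t → EuclideanSpace ℝ (Fin d))
    (Q : (t : ℕ) → Hist Ω t → Set (ProbabilityMeasure (Ω t))) : Prop :=
  ∀ t < T, ∃ A : Set (Hist Ω t), UnivMeasurableSet A ∧ IsFull (priors Q t) A ∧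
    ∀ ω ∈ A, GeomAt S Q t ω

/-- The quantitative no-arbitrage condition. -/
def QuantitativeNA (T : ℕ) (S : (t : ℕ) → Hist Ω t → EuclideanSpace ℝ (Fin d))
    (Q : (t : ℕ) → Hist Ω t → Set (ProbabilityMeasure (Ω t))) : Prop :=
  ∀ t < T, ∃ A : Set (Hist Ω t), UnivMeasurableSet A ∧ IsFull (priors Q t) A ∧
    ∀ ω ∈ A, QuantAt S Q t ω

end Model

end QuasiSure

open QuasiSure

/-!
The proof reduces both conditions, at a fixed history, to one property of the support `D` of the
price increment, `NoHalfSpace`: every half-space through `0` that contains `D` has `D` in its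
boundary hyperplane. Let `f 0, f 1, …` be dense in `D` and let `L` be the span of `D`. If
`NoHalfSpace D` holds, then by compactness of the unit sphere of `L` some polytope
`conv {f 0, …, f k}` contains a ball of `L`, with a radius `1 / (k + 1)` that can be read off from
the index `k`; this is `Dominates f k`, obtained in `exists_dominates`. Conversely such a ball puts
`0` in the relative interior of `conv D`, and this implies `NoHalfSpace D`. The same ball gives
in each direction of `L` a point `f n` with a loss of at least `1 / (k + 1)`. Some one-period
prior charges a neighbourhood of that point, and compactness again makes its probability uniform
(`Dominates.exists_loss`). Uniform losses in turn exclude half-spaces (`noHalfSpace_of_loss`). So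
the geometric and the quantitative condition hold at the same histories.

For the measurability in the history, analytic sets are universally measurable
(`AnalyticSet.nullMeasurableSet`) and have universally measurable selections
(`AnalyticSet.exists_univMeasurable`, the Jankov–von Neumann theorem). The graph of `D` is
analytic, so the sequence `f` can be chosen universally measurable (`exists_castaing`), and
`Dominates f k` only has to be tested on countably many vectors (`dominates_iff_ratComb`). The
constants `ε` and `β` are functions of the first `k` for which it holds.

Finally, suppose that under the no-arbitrage condition `NoHalfSpace` failed with positive
probability under some prior `P`. After a modification on a `P`-null set one can select a
separating direction `φ` measurably, and a one-step kernel that charges the gains of `φ`. Holding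
`φ` in that single period never loses, since `D` lies on one side of the hyperplane, and it wins
with positive probability under the extension of `P` by the kernel: an arbitrage
(`NoArbitrage.isFull_noHalfSpace`). The other two assumptions give full measure directly.
-/

open Set Filter Topology

namespace QuasiSure

universe u

/-! ### Universally measurable sets and functions -/

section Universal

variable {X Y Z : Type*} [MeasurableSpace X] [MeasurableSpace Y] [MeasurableSpace Z]

theorem le_universalSigma : (inferInstance : MeasurableSpace X) ≤ universalSigma X :=
  fun _ hs _ => MeasurableSet.nullMeasurableSet hs

theorem _root_.Measurable.univMeasurable {f : X → Y} (hf : Measurable f) : UnivMeasurable f :=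
  hf.mono le_universalSigma le_rfl

theorem UnivMeasurable.aemeasurable [MeasurableSpace.CountablyGenerated Y] {f : X → Y}
    (hf : UnivMeasurable f) (μ : ProbabilityMeasure X) : AEMeasurable f (μ : Measure X) :=
  NullMeasurable.aemeasurable fun _ hs => hf hs μ

theorem _root_.Measurable.comp_univMeasurable {g : Y → Z} {f : X → Y} (hg : Measurable g)
    (hf : UnivMeasurable f) : UnivMeasurable (g ∘ f) :=
  Measurable.comp hg hf

open Classical in
theorem UnivMeasurable.ite {s : Set X} (hs : UnivMeasurableSet s) {f g : X → Y}
    (hf : UnivMeasurable f) (hg : UnivMeasurable g) :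
    UnivMeasurable fun x => if x ∈ s then f x else g x :=
  Measurable.ite (m := universalSigma X) hs hf hg

end Universal

/-! ### Analytic sets are universally measurable -/

section Analytic

variable {X : Type*} [TopologicalSpace X]

theorem isCompact_setOf_forall_le (k : ℕ → ℕ) : IsCompact {z : ℕ → ℕ | ∀ i, z i ≤ k i} := by
  have := isCompact_univ_pi (X := fun _ : ℕ => ℕ) (s := fun i => Iic (k i))
    fun i => (finite_Iic _).isCompact
  convert this using 1
  ext z
  simp [Pi.le_def]

/-- A neighbourhood of a compact box of the Baire space contains a set that restricts only
finitely many coordinates. -/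
theorem exists_forall_lt_le_subset_of_isOpen {k : ℕ → ℕ} {W : Set (ℕ → ℕ)} (hW : IsOpen W)
    (hk : {z : ℕ → ℕ | ∀ i, z i ≤ k i} ⊆ W) : ∃ n, {z : ℕ → ℕ | ∀ i < n, z i ≤ k i} ⊆ W := by
  by_contra! hcon
  have hcon' : ∀ n, ∃ z : ℕ → ℕ, (∀ i < n, z i ≤ k i) ∧ z ∉ W := fun n => by
    obtain ⟨z, hz, hzW⟩ := not_subset.1 (hcon n)
    exact ⟨z, hz, hzW⟩
  choose z hz hzW using hcon'
  -- truncation moves the sequence into the box without changing the limits of coordinates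
  obtain ⟨a, ha, φ, hφ, hlim⟩ := (isCompact_setOf_forall_le k).tendsto_subseq
    (x := fun n i => min (z n i) (k i)) fun n i => min_le_right _ _
  have hlim' : Tendsto (z ∘ φ) atTop (𝓝 a) := by
    rw [tendsto_pi_nhds] at hlim ⊢
    intro i
    refine (hlim i).congr' ?_
    filter_upwards [eventually_gt_atTop i] with n hn
    exact min_eq_left (hz (φ n) i (hn.trans_le (hφ.id_le n)))
  obtain ⟨n, hn⟩ := (hlim'.eventually (hW.mem_nhds (hk ha))).exists
  exact hzW _ hn

variable [T2Space X] [MeasurableSpace X] [OpensMeasurableSpace X]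

/-- Continuous images of the Baire space are inner regular: this is Choquet's capacitability
argument, which bounds one coordinate after the other. -/
theorem exists_isCompact_subset_range {g : (ℕ → ℕ) → X} (hg : Continuous g) (μ : Measure X)
    [IsFiniteMeasure μ] {r : ENNReal} (hr : r < μ (range g)) :
    ∃ K ⊆ range g, IsCompact K ∧ r ≤ μ K := by
  -- outer measure is continuous along increasing unions of arbitrary sets
  have step : ∀ (n : ℕ) (s : Set (ℕ → ℕ)), ∃ a : ℕ, r < μ (g '' s) →
      r < μ (g '' (s ∩ {z | z n ≤ a})) := by
    intro n s
    by_cases h : r < μ (g '' s)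
    · have hs : s = ⋃ a : ℕ, s ∩ {z | z n ≤ a} := by
        rw [← inter_iUnion]
        refine (inter_eq_left.2 fun z _ => mem_iUnion.2 ⟨z n, le_refl (z n)⟩).symm
      have hmono : Monotone fun a : ℕ => g '' (s ∩ {z | z n ≤ a}) := fun a b hab =>
        image_mono (inter_subset_inter_right _ fun z (hz : z n ≤ a) => hz.trans hab)
      have h' : r < ⨆ a : ℕ, μ (g '' (s ∩ {z | z n ≤ a})) := by
        rw [← hmono.directed_le.measure_iUnion, ← image_iUnion, ← hs]
        exact h
      obtain ⟨a, ha⟩ := lt_iSup_iff.1 h'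
      exact ⟨a, fun _ => ha⟩
    · exact ⟨0, fun h' => absurd h' h⟩
  choose a ha using step
  let T : ℕ → Set (ℕ → ℕ) := fun n => Nat.rec univ (fun n s => s ∩ {z | z n ≤ a n s}) n
  have hT : ∀ n, r < μ (g '' T n) := by
    intro n
    induction n with
    | zero => simpa [T] using hr
    | succ n ih => exact ha n (T n) ih
  let k : ℕ → ℕ := fun n => a n (T n)
  have hTk : ∀ n, T n = {z | ∀ i < n, z i ≤ k i} := by
    intro n
    induction n with
    | zero => simp [T]
    | succ n ih =>
      have : T (n + 1) = T n ∩ {z | z n ≤ k n} := rfl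
      rw [this, ih]
      ext z
      simp only [mem_inter_iff, mem_ofPred_eq, Nat.lt_succ_iff_lt_or_eq]
      constructor
      · rintro ⟨h1, h2⟩ i (hi | rfl)
        exacts [h1 i hi, h2]
      · exact fun h => ⟨fun i hi => h i (Or.inl hi), h n (Or.inr rfl)⟩
  refine ⟨g '' {z | ∀ i, z i ≤ k i}, image_subset_range _ _,
    (isCompact_setOf_forall_le k).image hg, ?_⟩
  have hsub : ⋂ n, closure (g '' T n) ⊆ g '' {z | ∀ i, z i ≤ k i} := by
    intro x hx
    by_contra hxK
    obtain ⟨U, V, hU, hV, hxU, hKV, hUV⟩ := SeparatedNhds.of_isCompact_isCompact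
      (isCompact_singleton (x := x)) ((isCompact_setOf_forall_le k).image hg) (by simpa using hxK)
    obtain ⟨n, hn⟩ := exists_forall_lt_le_subset_of_isOpen (hV.preimage hg)
      (image_subset_iff.1 hKV)
    rw [← hTk, ← image_subset_iff] at hn
    have hxn := mem_iInter.1 hx n
    obtain ⟨y, hyU, hyn⟩ := mem_closure_iff.1 hxn U hU (hxU rfl)
    exact disjoint_left.1 hUV hyU (hn hyn)
  refine le_trans ?_ (measure_mono hsub)
  have hanti : Antitone fun n => closure (g '' T n) :=
    antitone_nat_of_succ_le fun n => closure_mono (image_mono inter_subset_left)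
  rw [hanti.measure_iInter (fun n => isClosed_closure.measurableSet.nullMeasurableSet)
    ⟨0, measure_ne_top _ _⟩]
  exact le_iInf fun n => (hT n).le.trans (measure_mono subset_closure)

theorem _root_.MeasureTheory.AnalyticSet.nullMeasurableSet {s : Set X} (hs : AnalyticSet s)
    (μ : Measure X) [IsFiniteMeasure μ] : NullMeasurableSet s μ := by
  rw [AnalyticSet] at hs
  obtain rfl | ⟨g, hg, rfl⟩ := hs
  · exact MeasurableSet.empty.nullMeasurableSet
  rcases eq_or_ne (μ (range g)) 0 with h0 | h0
  · exact NullMeasurableSet.of_null h0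
  obtain ⟨u, -, hu, hulim⟩ := exists_seq_strictMono_tendsto' (pos_iff_ne_zero.2 h0)
  choose K hKs hK hKm using fun n => exists_isCompact_subset_range hg μ (hu n).2
  have hF : MeasurableSet (⋃ n, K n) := MeasurableSet.iUnion fun n => (hK n).isClosed.measurableSet
  have hle : μ (range g) ≤ μ (⋃ n, K n) :=
    le_of_tendsto' hulim fun n => (hKm n).trans (measure_mono (subset_iUnion _ _))
  exact hF.nullMeasurableSet.congr (ae_eq_of_subset_of_measure_ge (iUnion_subset hKs) hle
    hF.nullMeasurableSet (measure_ne_top _ _))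

theorem _root_.MeasureTheory.AnalyticSet.univMeasurableSet {s : Set X} (hs : AnalyticSet s) :
    UnivMeasurableSet s :=
  fun μ => hs.nullMeasurableSet (μ : Measure X)

end Analytic

/-! ### Universally measurable selection -/

theorem measurableSet_sInf_eq {X : Type*} {m : MeasurableSpace X} {B : ℕ → Set X}
    (hB : ∀ b, MeasurableSet (B b)) (a : ℕ) : MeasurableSet {x | sInf {b | x ∈ B b} = a} := by
  classical
  have hp : ∀ x, ∃ b, x ∈ B b ∨ ∀ c, x ∉ B c := fun x => by
    by_cases h : ∃ c, x ∈ B c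
    · exact ⟨h.choose, Or.inl h.choose_spec⟩
    · exact ⟨0, Or.inr fun c hc => h ⟨c, hc⟩⟩
  have hm : Measurable fun x => Nat.find (hp x) := by
    refine measurable_find hp fun b => (hB b).union ?_
    have : {x | ∀ c, x ∉ B c} = ⋂ c, (B c)ᶜ := by
      ext x; simp
    change MeasurableSet {x | ∀ c, x ∉ B c}
    rw [this]
    exact MeasurableSet.iInter fun c => (hB c).compl
  have heq : (fun x => sInf {b | x ∈ B b}) = fun x => Nat.find (hp x) := by
    funext x
    by_cases h : ∃ c, x ∈ B c
    · obtain ⟨c, hc⟩ := h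
      refine le_antisymm (Nat.sInf_le ?_) (Nat.find_min' _ (Or.inl ?_))
      · exact (Nat.find_spec (hp x)).resolve_right fun h => h c hc
      · exact Nat.sInf_mem (s := {b | x ∈ B b}) ⟨c, hc⟩
    · have h0 : Nat.find (hp x) = 0 := (Nat.find_eq_zero _).2 (Or.inr fun c hc => h ⟨c, hc⟩)
      rw [h0]
      refine Nat.sInf_eq_zero.2 (Or.inr ?_)
      exact eq_empty_of_forall_notMem fun c hc => h ⟨c, hc⟩
  have : {x | sInf {b | x ∈ B b} = a} = (fun x => Nat.find (hp x)) ⁻¹' {a} := by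
    rw [← heq]; rfl
  rw [this]
  exact hm (measurableSet_singleton a)

section Selection

variable {X : Type*}

/-- The set of points of the Baire space whose initial segment is the list `s`. -/
def baireCylinder (s : List ℕ) : Set (ℕ → ℕ) := {z | (List.range s.length).map z = s}

/-- The least `a` such that the fibre of `g` over `x` meets the cylinder of `s ++ [a]`. -/
noncomputable def leftmostStep (g : (ℕ → ℕ) → X) (x : X) (s : List ℕ) : ℕ :=
  sInf {a | x ∈ g '' baireCylinder (s ++ [a])}

/-- The initial segment of length `n` of the leftmost branch of the fibre of `g` over `x`. -/
noncomputable def leftmostPrefix (g : (ℕ → ℕ) → X) (x : X) : ℕ → List ℕ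
  | 0 => []
  | n + 1 => leftmostPrefix g x n ++ [leftmostStep g x (leftmostPrefix g x n)]

/-- The lexicographically smallest point of the fibre of `g` over `x`. -/
noncomputable def leftmostBranch (g : (ℕ → ℕ) → X) (x : X) (n : ℕ) : ℕ :=
  leftmostStep g x (leftmostPrefix g x n)

theorem leftmostPrefix_eq (g : (ℕ → ℕ) → X) (x : X) (n : ℕ) :
    leftmostPrefix g x n = (List.range n).map (leftmostBranch g x) := by
  induction n with
  | zero => rfl
  | succ n ih =>
    rw [List.range_succ, List.map_append, ← ih]
    rfl

theorem mem_image_leftmostPrefix (g : (ℕ → ℕ) → X) (z : ℕ → ℕ) (n : ℕ) :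
    g z ∈ g '' baireCylinder (leftmostPrefix g (g z) n) := by
  induction n with
  | zero => exact ⟨z, rfl, rfl⟩
  | succ n ih =>
    obtain ⟨y, hy, hyz⟩ := ih
    refine Nat.sInf_mem (s := {a | g z ∈ g '' baireCylinder (leftmostPrefix g (g z) n ++ [a])})
      ⟨y (leftmostPrefix g (g z) n).length, y, ?_, hyz⟩
    have hy' : (List.range (leftmostPrefix g (g z) n).length).map y =
      leftmostPrefix g (g z) n := hy
    change (List.range _).map y = _
    rw [List.length_append, List.length_singleton, List.range_succ, List.map_append, hy']
    rfl

theorem apply_leftmostBranch [TopologicalSpace X] [T2Space X] {g : (ℕ → ℕ) → X}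
    (hg : Continuous g) (z : ℕ → ℕ) : g (leftmostBranch g (g z)) = g z := by
  choose y hy hyz using mem_image_leftmostPrefix g z
  have hlim : Tendsto y atTop (𝓝 (leftmostBranch g (g z))) := by
    rw [tendsto_pi_nhds]
    intro i
    refine tendsto_const_nhds.congr' ?_
    filter_upwards [eventually_gt_atTop i] with n hn
    have h : (List.range (leftmostPrefix g (g z) n).length).map (y n) =
      leftmostPrefix g (g z) n := hy n
    rw [leftmostPrefix_eq, List.length_map, List.length_range] at h
    exact (List.map_inj_left.1 h i (List.mem_range.2 hn)).symm
  refine tendsto_nhds_unique ((hg.tendsto _).comp hlim) ?_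
  simp [Function.comp_def, hyz]

variable [TopologicalSpace X] [T2Space X] [MeasurableSpace X] [OpensMeasurableSpace X]

theorem isClopen_baireCylinder (s : List ℕ) : IsClopen (baireCylinder s) := by
  have : baireCylinder s = ⋂ i : Fin s.length, {z | z i = s[i]} := by
    ext z
    simp only [mem_iInter]
    constructor
    · intro h i
      have h' : (List.range s.length).map z = s := h
      have := List.getElem_of_eq h' (i := i) (by simp)
      simpa using this
    · intro h
      refine List.ext_getElem (by simp) fun i h1 h2 => ?_
      simpa using h ⟨i, h2⟩
  rw [this]
  exact isClopen_iInter_of_finite fun i =>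
    (isClopen_discrete {s[i]}).preimage (continuous_apply (i : ℕ))

theorem univMeasurableSet_image_baireCylinder {g : (ℕ → ℕ) → X} (hg : Continuous g)
    (s : List ℕ) : UnivMeasurableSet (g '' baireCylinder s) :=
  ((isClopen_baireCylinder s).isOpen.analyticSet_image hg).univMeasurableSet

theorem univMeasurableSet_leftmostStep_eq {g : (ℕ → ℕ) → X} (hg : Continuous g) (s : List ℕ)
    (a : ℕ) : UnivMeasurableSet {x | leftmostStep g x s = a} :=
  measurableSet_sInf_eq (m := universalSigma X)
    (fun b => univMeasurableSet_image_baireCylinder hg (s ++ [b])) a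

theorem univMeasurableSet_leftmostPrefix_eq {g : (ℕ → ℕ) → X} (hg : Continuous g) (n : ℕ)
    (s : List ℕ) : UnivMeasurableSet {x | leftmostPrefix g x n = s} := by
  induction n generalizing s with
  | zero => exact MeasurableSet.const (m := universalSigma X) ([] = s)
  | succ n ih =>
    have : {x | leftmostPrefix g x (n + 1) = s} = ⋃ t : List ℕ, ⋃ a : ℕ,
        ({x | leftmostPrefix g x n = t} ∩ {x | leftmostStep g x t = a}) ∩
          {_x | t ++ [a] = s} := by
      ext x
      simp only [mem_iUnion]
      constructor
      · intro h
        exact ⟨_, _, ⟨rfl, rfl⟩, h⟩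
      · rintro ⟨t, a, ⟨rfl, rfl⟩, h⟩
        exact h
    have hstep := univMeasurableSet_leftmostStep_eq hg
    rw [this]
    let _ := universalSigma X
    exact MeasurableSet.iUnion fun t => MeasurableSet.iUnion fun a =>
      MeasurableSet.inter (MeasurableSet.inter (ih t) (hstep t a)) (MeasurableSet.const _)

theorem univMeasurable_leftmostBranch {g : (ℕ → ℕ) → X} (hg : Continuous g) :
    UnivMeasurable (leftmostBranch g) := by
  have hpre := univMeasurableSet_leftmostPrefix_eq hg
  have hstep := univMeasurableSet_leftmostStep_eq hg
  let _ := universalSigma X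
  refine measurable_pi_iff.2 fun n => measurable_to_countable' fun a => ?_
  have : (fun x => leftmostBranch g x n) ⁻¹' {a} = ⋃ t : List ℕ,
      {x | leftmostPrefix g x n = t} ∩ {x | leftmostStep g x t = a} := by
    ext x
    simp only [mem_iUnion]
    constructor
    · intro h
      exact ⟨_, rfl, h⟩
    · rintro ⟨t, rfl, h⟩
      exact h
  rw [this]
  exact MeasurableSet.iUnion fun t => MeasurableSet.inter (hpre n t) (hstep t a)

/-- The **Jankov–von Neumann selection theorem**. The selection is given through a continuous
parametrization `f` of (part of) the analytic set by the Baire space. -/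
theorem _root_.MeasureTheory.AnalyticSet.exists_selection {Y : Type*} [TopologicalSpace Y]
    {A : Set (X × Y)} (hA : AnalyticSet A) (hne : A.Nonempty) :
    ∃ (f : (ℕ → ℕ) → X × Y) (φ : X → ℕ → ℕ), Continuous f ∧ UnivMeasurable φ ∧
      ∀ x ∈ Prod.fst '' A, f (φ x) ∈ A ∧ (f (φ x)).1 = x := by
  rw [AnalyticSet] at hA
  obtain rfl | ⟨f, hf, rfl⟩ := hA
  · simp at hne
  have hg : Continuous (Prod.fst ∘ f) := continuous_fst.comp hf
  refine ⟨f, leftmostBranch (Prod.fst ∘ f), hf, univMeasurable_leftmostBranch hg, ?_⟩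
  rintro _ ⟨_, ⟨z, rfl⟩, rfl⟩
  exact ⟨mem_range_self _, apply_leftmostBranch hg z⟩

open Classical in
/-- Selection of points from the sections of an analytic set, with a prescribed value at the
points whose section is empty. -/
theorem _root_.MeasureTheory.AnalyticSet.exists_univMeasurable {Y : Type*} [TopologicalSpace Y]
    [MeasurableSpace Y] {A : Set (X × Y)}
    (hY : (inferInstance : MeasurableSpace Y) ≤ borel Y) (hA : AnalyticSet A)
    {h : X → Y} (hh : UnivMeasurable h) : ∃ φ : X → Y, UnivMeasurable φ ∧
      (∀ x ∈ Prod.fst '' A, (x, φ x) ∈ A) ∧ ∀ x ∉ Prod.fst '' A, φ x = h x := by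
  rcases A.eq_empty_or_nonempty with rfl | hne
  · exact ⟨h, hh, by simp, by simp⟩
  obtain ⟨f, φ, hf, hφ, hfφ⟩ := hA.exists_selection hne
  have hmeas : Measurable fun z => (f z).2 :=
    (continuous_snd.comp hf).borel_measurable.mono (BorelSpace.measurable_eq.ge) hY
  refine ⟨fun x => if x ∈ Prod.fst '' A then (f (φ x)).2 else h x,
    UnivMeasurable.ite (hA.image_of_continuous continuous_fst).univMeasurableSet
      (hmeas.comp_univMeasurable hφ) hh, fun x hx => ?_,
    fun x hx => if_neg hx⟩
  obtain ⟨h1, h2⟩ := hfφ x hx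
  beta_reduce
  rw [if_pos hx]
  rwa [← Prod.mk.eta (p := f (φ x)), h2] at h1

end Selection

/-! ### Convex geometry of the no-arbitrage condition -/

section Geometry

variable {E : Type*} [NormedAddCommGroup E] [InnerProductSpace ℝ E]

/-- No half-space with `0` on its boundary contains `D` unless its boundary already does. -/
def NoHalfSpace (D : Set E) : Prop :=
  ∀ h : E, (∀ y ∈ D, 0 ≤ inner ℝ h y) → ∀ y ∈ D, inner ℝ h y = 0

/-- The support function of the polytope spanned by `f 0, …, f k` is bounded below on the span `L`
of the sequence `f` by that of the ball of radius `1 / (k + 1)` in `L`. It is written as a closed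
condition in `h` and `g`, without the orthogonal projection on `L`. -/
def Dominates (f : ℕ → E) (k : ℕ) : Prop :=
  ∀ h : E, ∀ g ∈ Submodule.span ℝ (range f),
    ∃ n ≤ k, inner ℝ h g ≤ (k + 1) * ‖g‖ * inner ℝ h (f n)

theorem noHalfSpace_of_mem_intrinsicInterior {D : Set E}
    (h0 : (0 : E) ∈ intrinsicInterior ℝ (convexHull ℝ D)) : NoHalfSpace D := by
  intro h hD y hy
  refine le_antisymm (le_of_not_gt fun hpos => ?_) (hD y hy)
  obtain ⟨x, hx, hx0⟩ := mem_intrinsicInterior.1 h0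
  obtain ⟨ε, hε, hball⟩ := Metric.mem_nhds_iff.1 (mem_interior_iff_mem_nhds.1 hx)
  have hy' : y ∈ affineSpan ℝ (convexHull ℝ D) :=
    subset_affineSpan ℝ _ (subset_convexHull ℝ D hy)
  set δ : ℝ := ε / (2 * (‖y‖ + 1)) with hδ
  have hδ0 : 0 < δ := by positivity
  have hmem : (-δ) • y ∈ affineSpan ℝ (convexHull ℝ D) := by
    have := AffineMap.lineMap_mem (-δ) (hx0 ▸ x.2) hy'
    simpa [AffineMap.lineMap_apply] using this
  have hconv : (-δ) • y ∈ convexHull ℝ D := by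
    refine hball (a := ⟨(-δ) • y, hmem⟩) ?_
    rw [Metric.mem_ball, Subtype.dist_eq, hx0, dist_zero_right, norm_smul, norm_neg,
      Real.norm_of_nonneg hδ0.le, hδ, div_mul_eq_mul_div, div_lt_iff₀ (by positivity)]
    nlinarith [norm_nonneg y]
  have hhalf : convexHull ℝ D ⊆ {x | 0 ≤ inner ℝ h x} :=
    convexHull_min hD (convex_halfSpace_ge (innerₛₗ ℝ h).isLinear 0)
  have := hhalf hconv
  change 0 ≤ inner ℝ h ((-δ) • y) at this
  rw [inner_smul_right] at this
  nlinarith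

theorem span_eq_span_range [FiniteDimensional ℝ E] {D : Set E} {f : ℕ → E} (hf : ∀ n, f n ∈ D)
    (hD : D ⊆ closure (range f)) : Submodule.span ℝ D = Submodule.span ℝ (range f) := by
  refine le_antisymm (Submodule.span_le.2 fun y hy => ?_)
    (Submodule.span_mono (range_subset_iff.2 hf))
  exact closure_minimal Submodule.subset_span
    (Submodule.closed_of_finiteDimensional _) (hD hy)

theorem exists_dominates [FiniteDimensional ℝ E] {D : Set E} (hH : NoHalfSpace D) {f : ℕ → E}
    (hf : ∀ n, f n ∈ D) (hD : D ⊆ closure (range f)) : ∃ k, Dominates f k := by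
  set L := Submodule.span ℝ (range f) with hL
  have hK : IsCompact ((L : Set E) ∩ Metric.sphere 0 1) :=
    (isCompact_sphere 0 1).inter_left (Submodule.closed_of_finiteDimensional L)
  let U : ℕ → Set E := fun k => ⋃ n ∈ Iic k, {h | 1 / ((k : ℝ) + 1) < inner ℝ h (f n)}
  have hU : ∀ k, IsOpen (U k) := fun k => isOpen_biUnion fun n _ =>
    isOpen_lt continuous_const (continuous_id.inner continuous_const)
  have hUmono : Monotone U := by
    intro k l hkl h hh
    simp only [U, mem_iUnion] at hh ⊢
    obtain ⟨n, hn, hlt⟩ := hh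
    exact ⟨n, le_trans hn hkl, lt_of_le_of_lt (b := 1 / ((k : ℝ) + 1))
      (Nat.one_div_le_one_div hkl) hlt⟩
  have hcov : (L : Set E) ∩ Metric.sphere 0 1 ⊆ ⋃ k, U k := by
    rintro h ⟨hhL, hh1⟩
    have hh1 : ‖h‖ = 1 := by simpa using hh1
    have : ∃ n, 0 < inner ℝ h (f n) := by
      by_contra! hcon
      have hneg : ∀ y ∈ D, 0 ≤ inner ℝ (-h) y := by
        intro y hy
        have hcl : IsClosed {y | 0 ≤ inner ℝ (-h) y} :=
          isClosed_le continuous_const (continuous_const.inner continuous_id)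
        refine closure_minimal (range_subset_iff.2 fun n => ?_) hcl (hD hy)
        change 0 ≤ inner ℝ (-h) (f n)
        rw [inner_neg_left]
        linarith [hcon n]
      have horth : L ≤ (ℝ ∙ h)ᗮ := by
        refine Submodule.span_le.2 (range_subset_iff.2 fun n => ?_)
        refine Submodule.mem_orthogonal_singleton_iff_inner_right.2 ?_
        have := hH (-h) hneg (f n) (hf n)
        rwa [inner_neg_left, neg_eq_zero] at this
      have := Submodule.mem_orthogonal_singleton_iff_inner_right.1 (horth hhL)
      rw [real_inner_self_eq_norm_sq, hh1] at this
      norm_num at this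
    obtain ⟨n, hn⟩ := this
    obtain ⟨m, hm⟩ := exists_nat_one_div_lt hn
    refine mem_iUnion.2 ⟨max n m, mem_biUnion (x := n) (le_max_left n m) ?_⟩
    exact lt_of_le_of_lt (Nat.one_div_le_one_div (le_max_right n m)) hm
  obtain ⟨k, hk⟩ := hK.elim_directed_cover U hU hcov hUmono.directed_le
  refine ⟨k, fun h g hg => ?_⟩
  -- Only the component of `h` in `L` matters.
  set h' : E := L.starProjection h with hh'
  have hinner : ∀ v ∈ L, inner ℝ h v = inner ℝ h' v := fun v hv =>
    (L.inner_starProjection_left_eq_right h v).symm ▸ by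
      rw [L.starProjection_eq_self_iff.2 hv]
  have hfL : ∀ n, f n ∈ L := fun n => Submodule.subset_span (mem_range_self n)
  rcases eq_or_ne h' 0 with h0 | h0
  · refine ⟨0, Nat.zero_le _, ?_⟩
    rw [hinner g hg, hinner _ (hfL 0), h0, inner_zero_left, inner_zero_left, mul_zero]
  have hn0 : 0 < ‖h'‖ := norm_pos_iff.2 h0
  have hu := hk (a := ‖h'‖⁻¹ • h') ⟨L.smul_mem _ (L.starProjection_apply_mem h), by
    rw [mem_sphere_zero_iff_norm, norm_smul, norm_inv, norm_norm, inv_mul_cancel₀ hn0.ne']⟩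
  simp only [U, mem_iUnion] at hu
  obtain ⟨n, hnk, hlt⟩ := hu
  refine ⟨n, hnk, ?_⟩
  change 1 / ((k : ℝ) + 1) < inner ℝ (‖h'‖⁻¹ • h') (f n) at hlt
  rw [real_inner_smul_left, inv_mul_eq_div, div_lt_div_iff₀ (by positivity) hn0] at hlt
  rw [hinner g hg, hinner _ (hfL n)]
  calc inner ℝ h' g ≤ ‖h'‖ * ‖g‖ := real_inner_le_norm _ _
    _ ≤ (inner ℝ h' (f n) * (k + 1)) * ‖g‖ := by gcongr; linarith
    _ = _ := by ring

theorem Dominates.exists_inner_nonneg {f : ℕ → E} {k : ℕ} (hk : Dominates f k) (h : E) :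
    ∃ n ≤ k, 0 ≤ inner ℝ h (f n) := by
  by_contra! hcon
  have h0 := hcon 0 (Nat.zero_le k)
  obtain ⟨n, hn, hle⟩ := hk h (-f 0) (neg_mem (Submodule.subset_span (mem_range_self 0)))
  rw [inner_neg_right] at hle
  have h1 : (k + 1 : ℝ) * ‖-f 0‖ * inner ℝ h (f n) ≤ 0 :=
    mul_nonpos_of_nonneg_of_nonpos (by positivity) (hcon n hn).le
  linarith

theorem Dominates.ball_inter_span_subset {f : ℕ → E} {k : ℕ} [CompleteSpace E]
    (hk : Dominates f k) :
    Metric.ball 0 (1 / ((k : ℝ) + 1)) ∩ Submodule.span ℝ (range f) ⊆ convexHull ℝ (range f) := by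
  rintro g ⟨hgball, hg⟩
  have hgn : (k + 1) * ‖g‖ < 1 := by
    have : ‖g‖ < 1 / ((k : ℝ) + 1) := by simpa using hgball
    rwa [lt_div_iff₀ (by positivity), mul_comm] at this
  have hfin : (f '' Iic k).Finite := (finite_Iic k).image f
  suffices g ∈ convexHull ℝ (f '' Iic k) from
    convexHull_mono (image_subset_range f _) this
  by_contra hgC
  obtain ⟨l, u, hlu, hug⟩ := geometric_hahn_banach_closed_point (convex_convexHull ℝ _)
    (hfin.isCompact_convexHull ℝ).isClosed hgC
  set h : E := (InnerProductSpace.toDual ℝ E).symm l with hh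
  have hl : ∀ v, l v = inner ℝ h v := fun v => (InnerProductSpace.toDual_symm_apply).symm
  have hlt : ∀ n ≤ k, inner ℝ h (f n) < inner ℝ h g := fun n hn => by
    rw [← hl, ← hl]
    exact (hlu _ (subset_convexHull ℝ _ (mem_image_of_mem f hn))).trans hug
  obtain ⟨n, hn, hle⟩ := hk h g hg
  rcases le_total 0 (inner ℝ h (f n)) with h0 | h0
  · nlinarith [hlt n hn]
  · obtain ⟨m, hm, hm0⟩ := hk.exists_inner_nonneg h
    have h1 : (k + 1 : ℝ) * ‖g‖ * inner ℝ h (f n) ≤ 0 :=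
      mul_nonpos_of_nonneg_of_nonpos (by positivity) h0
    linarith [hlt m hm]

theorem mem_intrinsicInterior_of_ball_inter_subset {D : Set E} {ε : ℝ} (hε : 0 < ε)
    (h : Metric.ball 0 ε ∩ Submodule.span ℝ D ⊆ convexHull ℝ D) :
    (0 : E) ∈ intrinsicInterior ℝ (convexHull ℝ D) := by
  have h0 : (0 : E) ∈ convexHull ℝ D := h ⟨Metric.mem_ball_self hε, zero_mem _⟩
  refine mem_intrinsicInterior.2 ⟨⟨0, subset_affineSpan ℝ _ h0⟩, ?_, rfl⟩
  refine mem_interior.2 ⟨Subtype.val ⁻¹' Metric.ball 0 ε, ?_,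
    Metric.isOpen_ball.preimage continuous_subtype_val, Metric.mem_ball_self hε⟩
  rintro ⟨x, hx⟩ hxε
  rw [affineSpan_convexHull] at hx
  exact h ⟨hxε, affineSpan_subset_span hx⟩

theorem noHalfSpace_iff_exists_dominates [FiniteDimensional ℝ E] {D : Set E} {f : ℕ → E}
    (hf : ∀ n, f n ∈ D) (hD : D ⊆ closure (range f)) :
    NoHalfSpace D ↔ ∃ k, Dominates f k := by
  refine ⟨fun h => exists_dominates h hf hD, ?_⟩
  rintro ⟨k, hk⟩
  have := FiniteDimensional.complete ℝ E
  have hsub := hk.ball_inter_span_subset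
  rw [← span_eq_span_range hf hD] at hsub
  exact noHalfSpace_of_mem_intrinsicInterior (mem_intrinsicInterior_of_ball_inter_subset
    (by positivity) (hsub.trans (convexHull_mono (range_subset_iff.2 hf))))

theorem Dominates.ball_inter_span_subset_convexHull [FiniteDimensional ℝ E] {D : Set E}
    {f : ℕ → E} (hf : ∀ n, f n ∈ D) (hD : D ⊆ closure (range f)) {k : ℕ} (hk : Dominates f k) :
    Metric.ball 0 (1 / ((k : ℝ) + 1)) ∩ Submodule.span ℝ D ⊆ convexHull ℝ D := by
  have := FiniteDimensional.complete ℝ E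
  rw [span_eq_span_range hf hD]
  exact hk.ball_inter_span_subset.trans (convexHull_mono (range_subset_iff.2 hf))

theorem mem_intrinsicInterior_iff_noHalfSpace [FiniteDimensional ℝ E] {D : Set E} {f : ℕ → E}
    (hf : ∀ n, f n ∈ D) (hD : D ⊆ closure (range f)) :
    (0 : E) ∈ intrinsicInterior ℝ (convexHull ℝ D) ↔ NoHalfSpace D := by
  refine ⟨noHalfSpace_of_mem_intrinsicInterior, fun h => ?_⟩
  obtain ⟨k, hk⟩ := exists_dominates h hf hD
  exact mem_intrinsicInterior_of_ball_inter_subset (by positivity)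
    (hk.ball_inter_span_subset_convexHull hf hD)

end Geometry

/-! ### The quasi-sure support of a random vector -/

section Support

variable {Y E : Type*} [MeasurableSpace Y] [NormedAddCommGroup E]

/-- The smallest closed set that contains the random vector `Δ` almost surely under each of the
probability measures in `Q`. -/
def quasiSupport (Δ : Y → E) (Q : Set (ProbabilityMeasure Y)) : Set E :=
  ⋂₀ {A | IsClosed A ∧ ∀ p ∈ Q, (p : Measure Y) {w | Δ w ∈ A} = 1}

variable [MeasurableSpace E] [BorelSpace E] {Δ : Y → E} {Q : Set (ProbabilityMeasure Y)}

theorem mem_quasiSupport_iff (hΔ : Measurable Δ) {y : E} :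
    y ∈ quasiSupport Δ Q ↔
      ∀ ε > 0, ∃ p ∈ Q, 0 < (p : Measure Y) {w | Δ w ∈ Metric.ball y ε} := by
  constructor
  · intro hy ε hε
    by_contra! hcon
    have hmem : (Metric.ball y ε)ᶜ ∈
        {A | IsClosed A ∧ ∀ p ∈ Q, (p : Measure Y) {w | Δ w ∈ A} = 1} := by
      refine ⟨Metric.isOpen_ball.isClosed_compl, fun p hp => ?_⟩
      exact (prob_compl_eq_one_iff (hΔ measurableSet_ball)).2 (le_antisymm (hcon p hp) zero_le)
    exact hy _ hmem (Metric.mem_ball_self hε)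
  · rintro h A ⟨hA, hA1⟩
    by_contra hyA
    obtain ⟨ε, hε, hball⟩ := Metric.isOpen_iff.1 hA.isOpen_compl y hyA
    obtain ⟨p, hp, hpos⟩ := h ε hε
    have h0 : (p : Measure Y) (Δ ⁻¹' A)ᶜ = 0 :=
      (prob_compl_eq_zero_iff (hΔ hA.measurableSet)).2 (hA1 p hp)
    exact hpos.ne' (measure_mono_null (fun w hw => hball hw) h0)

theorem ae_mem_quasiSupport [SecondCountableTopology E] (hΔ : Measurable Δ)
    {p : ProbabilityMeasure Y} (hp : p ∈ Q) : ∀ᵐ w ∂(p : Measure Y), Δ w ∈ quasiSupport Δ Q := by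
  let 𝒰 : Set (Set E) :=
    {U | Uᶜ ∈ {A | IsClosed A ∧ ∀ p ∈ Q, (p : Measure Y) {w | Δ w ∈ A} = 1}}
  obtain ⟨T, hT, hTU, hTeq⟩ := TopologicalSpace.isOpen_sUnion_countable 𝒰
    fun U hU => isClosed_compl_iff.1 hU.1
  have hsub : ∀ w, Δ w ∉ quasiSupport Δ Q → Δ w ∈ ⋃₀ T := by
    intro w hw
    rw [hTeq]
    simp only [quasiSupport, mem_sInter, not_forall] at hw
    obtain ⟨A, hA, hwA⟩ := hw
    refine ⟨Aᶜ, ?_, hwA⟩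
    rwa [← compl_compl A] at hA
  have hnull : ∀ᵐ w ∂(p : Measure Y), ∀ U ∈ T, Δ w ∉ U := by
    refine (ae_ball_iff hT).2 fun U hU => ?_
    have hU' := hTU hU
    have h0 : (p : Measure Y) (Δ ⁻¹' Uᶜ)ᶜ = 0 :=
      (prob_compl_eq_zero_iff (hΔ hU'.1.measurableSet)).2 (hU'.2 p hp)
    rw [← preimage_compl, compl_compl] at h0
    exact measure_eq_zero_iff_ae_notMem.1 h0
  filter_upwards [hnull] with w hw
  by_contra hwD
  obtain ⟨U, hU, hwU⟩ := hsub w hwD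
  exact hw U hU hwU

theorem quasiSupport_nonempty [SecondCountableTopology E] (hΔ : Measurable Δ)
    (hQ : Q.Nonempty) : (quasiSupport Δ Q).Nonempty := by
  obtain ⟨p, hp⟩ := hQ
  obtain ⟨w, hw⟩ := (ae_mem_quasiSupport hΔ hp).exists
  exact ⟨_, hw⟩

/-! ### The quantitative condition -/

variable [InnerProductSpace ℝ E] [FiniteDimensional ℝ E]

/-- A uniform loss for the directions in the affine hull of the support excludes half-spaces.
That the affine hull is a linear subspace is part of the argument: otherwise its point of least
norm would be a direction without losses. -/
theorem noHalfSpace_of_loss (hΔ : Measurable Δ) (hQ : Q.Nonempty)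
    {β κ : ℝ} (hβ : 0 < β) (hκ : 0 < κ)
    (h : ∀ h ∈ affineSpan ℝ (quasiSupport Δ Q), h ≠ 0 →
      ∃ p ∈ Q, κ ≤ (p : Measure Y).real {w | inner ℝ h (Δ w) < -β * ‖h‖}) :
    NoHalfSpace (quasiSupport Δ Q) := by
  set D := quasiSupport Δ Q with hD
  have key : ∀ h ∈ affineSpan ℝ D, (∀ y ∈ D, 0 ≤ inner ℝ h y) → h = 0 := by
    intro v hv hvD
    by_contra hv0
    obtain ⟨p, hp, hpκ⟩ := h v hv hv0
    have hnull : (p : Measure Y) {w | inner ℝ v (Δ w) < -β * ‖v‖} = 0 := by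
      refine measure_mono_null ?_ (ae_mem_quasiSupport hΔ hp)
      intro w (hw : inner ℝ v (Δ w) < -β * ‖v‖) hwD
      have h1 := hvD _ hwD
      have h2 : 0 ≤ β * ‖v‖ := by positivity
      linarith
    rw [Measure.real, hnull, ENNReal.toReal_zero] at hpκ
    linarith
  obtain ⟨y₀, hy₀⟩ := quasiSupport_nonempty hΔ hQ
  have hy₀A : y₀ ∈ affineSpan ℝ D := subset_affineSpan ℝ D hy₀
  set V := (affineSpan ℝ D).direction with hV
  -- the point of least norm of the affine hull
  have hm : y₀ - V.starProjection y₀ ∈ affineSpan ℝ D := by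
    have := AffineSubspace.vadd_mem_of_mem_direction
      (V.neg_mem (V.starProjection_apply_mem y₀)) hy₀A
    rwa [vadd_eq_add, neg_add_eq_sub] at this
  have horth : ∀ v ∈ V, inner ℝ (y₀ - V.starProjection y₀) v = 0 := fun v hv =>
    V.starProjection_inner_eq_zero y₀ v hv
  have hinner : ∀ y ∈ affineSpan ℝ D, inner ℝ (y₀ - V.starProjection y₀) y =
      ‖y₀ - V.starProjection y₀‖ ^ 2 := by
    intro y hy
    have hdir : y - (y₀ - V.starProjection y₀) ∈ V :=
      AffineSubspace.vsub_mem_direction hy hm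
    have := horth _ hdir
    rwa [inner_sub_right, sub_eq_zero, real_inner_self_eq_norm_sq] at this
  have hm0 : y₀ - V.starProjection y₀ = 0 := key _ hm fun y hy => by
    rw [hinner y (subset_affineSpan ℝ D hy)]
    positivity
  have h0 : (0 : E) ∈ affineSpan ℝ D := hm0 ▸ hm
  have hmemV : ∀ y, y ∈ affineSpan ℝ D ↔ y ∈ V := fun y => by
    have := AffineSubspace.vsub_right_mem_direction_iff_mem h0 y
    rw [vsub_eq_sub, sub_zero] at this
    exact this.symm
  intro v hvD
  have hproj : ∀ y ∈ D, inner ℝ v y = inner ℝ (V.starProjection v) y := fun y hy => by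
    rw [V.inner_starProjection_left_eq_right,
      V.starProjection_eq_self_iff.2 ((hmemV y).1 (subset_affineSpan ℝ D hy))]
  have hv0 := key (V.starProjection v) ((hmemV _).2 (V.starProjection_apply_mem v))
    fun y hy => hproj y hy ▸ hvD y hy
  intro y hy
  rw [hproj y hy, hv0, inner_zero_left]

/-- The probability of a loss can be bounded below uniformly in the direction, because the
directions form a compact set. -/
theorem Dominates.exists_loss (hΔ : Measurable Δ) {f : ℕ → E}
    (hf : ∀ n, f n ∈ quasiSupport Δ Q) (hD : quasiSupport Δ Q ⊆ closure (range f)) {k : ℕ}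
    (hk : Dominates f k) :
    ∃ κ ∈ Ioo (0 : ℝ) 1, ∀ h ∈ Submodule.span ℝ (quasiSupport Δ Q), h ≠ 0 →
      ∃ p ∈ Q, κ ≤
        (p : Measure Y).real {w | inner ℝ h (Δ w) < -(1 / (4 * ((k : ℝ) + 1))) * ‖h‖} := by
  set c : ℝ := 1 / (4 * ((k : ℝ) + 1)) with hc
  have hc0 : 0 < c := by positivity
  set L := Submodule.span ℝ (quasiSupport Δ Q) with hL
  have hK : IsCompact ((L : Set E) ∩ Metric.sphere 0 1) :=
    (isCompact_sphere 0 1).inter_left (Submodule.closed_of_finiteDimensional L)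
  have hunif : ∃ κ > 0, ∀ h ∈ (L : Set E) ∩ Metric.sphere 0 1,
      ∃ p ∈ Q, κ ≤ (p : Measure Y).real {w | inner ℝ h (Δ w) < -c} := by
    refine hK.induction_on (p := fun s => ∃ κ > 0, ∀ h ∈ s,
      ∃ p ∈ Q, κ ≤ (p : Measure Y).real {w | inner ℝ h (Δ w) < -c}) ?_ ?_ ?_ ?_
    · exact ⟨1, one_pos, by simp⟩
    · rintro s t hst ⟨κ, hκ, h⟩
      exact ⟨κ, hκ, fun v hv => h v (hst hv)⟩
    · rintro s t ⟨κ, hκ, h⟩ ⟨κ', hκ', h'⟩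
      refine ⟨min κ κ', lt_min hκ hκ', ?_⟩
      rintro v (hv | hv)
      · obtain ⟨p, hp, hle⟩ := h v hv
        exact ⟨p, hp, (min_le_left _ _).trans hle⟩
      · obtain ⟨p, hp, hle⟩ := h' v hv
        exact ⟨p, hp, (min_le_right _ _).trans hle⟩
    · rintro h ⟨hhL, hh1⟩
      have hh1 : ‖h‖ = 1 := by simpa using hh1
      have hhL' : -h ∈ Submodule.span ℝ (range f) := by
        rw [← span_eq_span_range hf hD]
        exact neg_mem hhL
      obtain ⟨n, -, hn⟩ := hk (-h) (-h) hhL'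
      rw [real_inner_self_eq_norm_sq, norm_neg, hh1, inner_neg_left] at hn
      have hn' : inner ℝ h (f n) ≤ -(4 * c) := by
        have : 4 * c = 1 / ((k : ℝ) + 1) := by rw [hc]; field_simp
        rw [this, le_neg, div_le_iff₀ (by positivity)]
        linarith
      -- near the support point `f n` the loss exceeds `2 * c`
      obtain ⟨p, hp, hpos⟩ := (mem_quasiSupport_iff hΔ).1 (hf n) (2 * c) (by positivity)
      have hloss : {w | Δ w ∈ Metric.ball (f n) (2 * c)} ⊆
          ⋃ R : ℕ, {w | inner ℝ h (Δ w) < -(2 * c) ∧ ‖Δ w‖ ≤ R} := by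
        intro w hw
        have hw : ‖Δ w - f n‖ < 2 * c := mem_ball_iff_norm.1 hw
        obtain ⟨R, hR⟩ := exists_nat_ge ‖Δ w‖
        refine mem_iUnion.2 ⟨R, ?_, hR⟩
        have h1 := real_inner_le_norm h (Δ w - f n)
        rw [hh1, one_mul, inner_sub_right] at h1
        linarith
      obtain ⟨R, hR⟩ : ∃ R : ℕ,
          0 < (p : Measure Y) {w | inner ℝ h (Δ w) < -(2 * c) ∧ ‖Δ w‖ ≤ R} := by
        by_contra! hcon
        exact hpos.ne' (measure_mono_null hloss
          (measure_iUnion_null fun R => le_antisymm (hcon R) zero_le))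
      refine ⟨Metric.ball h (c / (R + 1)), mem_nhdsWithin_of_mem_nhds
        (Metric.ball_mem_nhds h (by positivity)), _,
        ENNReal.toReal_pos hR.ne' (measure_ne_top _ _), fun v hv => ⟨p, hp, ?_⟩⟩
      refine measureReal_mono ?_
      rintro w ⟨hw1, hw2⟩
      have hv : ‖v - h‖ * (R + 1) < c := by
        rw [← lt_div_iff₀ (by positivity)]
        exact mem_ball_iff_norm.1 hv
      have h1 := real_inner_le_norm (v - h) (Δ w)
      rw [inner_sub_left] at h1
      have h2 : ‖v - h‖ * ‖Δ w‖ ≤ ‖v - h‖ * (R + 1) := by gcongr; linarith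
      change inner ℝ v (Δ w) < -c
      linarith
  obtain ⟨κ, hκ, hall⟩ := hunif
  refine ⟨min κ (1 / 2), ⟨lt_min hκ (by norm_num), (min_le_right _ _).trans_lt (by norm_num)⟩,
    fun h hh h0 => ?_⟩
  have hn0 : 0 < ‖h‖ := norm_pos_iff.2 h0
  obtain ⟨p, hp, hle⟩ := hall (‖h‖⁻¹ • h) ⟨L.smul_mem _ hh, by
    rw [mem_sphere_zero_iff_norm, norm_smul, norm_inv, norm_norm, inv_mul_cancel₀ hn0.ne']⟩
  refine ⟨p, hp, (min_le_left _ _).trans (hle.trans (measureReal_mono fun w hw => ?_))⟩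
  have hw : inner ℝ (‖h‖⁻¹ • h) (Δ w) < -c := hw
  rwa [real_inner_smul_left, inv_mul_eq_div, div_lt_iff₀ hn0] at hw

end Support

/-! ### Weak topology and evaluation of probability measures -/

section Giry

variable {Y : Type*} [TopologicalSpace Y] [PolishSpace Y] [MeasurableSpace Y] [BorelSpace Y]

theorem measurable_of_continuous_probabilityMeasure {Z : Type*} [TopologicalSpace Z]
    [MeasurableSpace Z] [OpensMeasurableSpace Z] {f : Z → ProbabilityMeasure Y}
    (hf : Continuous f) : Measurable f := by
  let _ := TopologicalSpace.upgradeIsCompletelyMetrizable Y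
  refine Measurable.subtype_mk (f := fun z => (f z : Measure Y)) ?_
  refine Measurable.measure_of_isPiSystem_of_isProbabilityMeasure
    (BorelSpace.measurable_eq (α := Y)) isPiSystem_isOpen fun U hU => ?_
  refine LowerSemicontinuous.measurable (lowerSemicontinuous_iff_le_liminf.2 fun z => ?_)
  exact ProbabilityMeasure.le_liminf_measure_open_of_tendsto (hf.tendsto z) hU

/-- The sigma-algebra on the space of probability measures that is generated by the evaluations
on Borel sets is contained in the Borel sigma-algebra of the weak topology. -/
theorem probabilityMeasure_measurableSpace_le_borel :
    (inferInstance : MeasurableSpace (ProbabilityMeasure Y)) ≤ borel (ProbabilityMeasure Y) := by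
  have : @Measurable _ _ (borel (ProbabilityMeasure Y)) _ (id : ProbabilityMeasure Y → _) :=
    @measurable_of_continuous_probabilityMeasure Y _ _ _ _ (ProbabilityMeasure Y) _
      (borel _) (@OpensMeasurableSpace.mk _ _ (borel _) le_rfl) id continuous_id
  exact fun s hs => this hs

variable {X : Type*} [TopologicalSpace X] [MeasurableSpace X] [BorelSpace X]

/-- Among the elements of an analytic set of pairs `(x, p)`, those for which `p` charges the
section at `x` of a given measurable set form an analytic set. -/
theorem _root_.MeasureTheory.AnalyticSet.setOf_measure_pos
    {A : Set (X × ProbabilityMeasure Y)} (hA : AnalyticSet A) {V : Set (X × Y)}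
    (hV : MeasurableSet V) :
    AnalyticSet {z | z ∈ A ∧ 0 < (z.2 : Measure Y) {w | (z.1, w) ∈ V}} := by
  rw [AnalyticSet] at hA
  obtain rfl | ⟨f, hf, rfl⟩ := hA
  · simpa using analyticSet_empty
  have hκ : Measurable fun z => ((f z).2 : Measure Y) :=
    measurable_subtype_coe.comp
      (measurable_of_continuous_probabilityMeasure (continuous_snd.comp hf))
  let κ : ProbabilityTheory.Kernel (ℕ → ℕ) Y := ⟨fun z => ((f z).2 : Measure Y), hκ⟩
  have : ProbabilityTheory.IsMarkovKernel κ :=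
    ⟨fun z => inferInstanceAs (IsProbabilityMeasure ((f z).2 : Measure Y))⟩
  have hmeas : Measurable fun z => ((f z).2 : Measure Y) {w | ((f z).1, w) ∈ V} := by
    have hV' : MeasurableSet {x : (ℕ → ℕ) × Y | ((f x.1).1, x.2) ∈ V} :=
      (((continuous_fst.comp hf).measurable.comp measurable_fst).prodMk measurable_snd) hV
    exact ProbabilityTheory.Kernel.measurable_kernel_prodMk_left (κ := κ) hV'
  convert ((hmeas measurableSet_Ioi :
    MeasurableSet {z | 0 < ((f z).2 : Measure Y) {w | ((f z).1, w) ∈ V}}).analyticSet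
      ).image_of_continuous hf using 1
  ext z
  constructor
  · rintro ⟨⟨a, rfl⟩, ha⟩
    exact ⟨a, ha, rfl⟩
  · rintro ⟨a, ha, rfl⟩
    exact ⟨mem_range_self a, ha⟩

end Giry

/-! ### Measurability of the support in the history -/

section Castaing

variable {X Y E : Type*} [TopologicalSpace X] [PolishSpace X] [MeasurableSpace X] [BorelSpace X]
  [TopologicalSpace Y] [PolishSpace Y] [MeasurableSpace Y] [BorelSpace Y]
  [NormedAddCommGroup E] [InnerProductSpace ℝ E] [FiniteDimensional ℝ E]
  [MeasurableSpace E] [BorelSpace E]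
  {Δ : X → Y → E} {Q : X → Set (ProbabilityMeasure Y)}

theorem analyticSet_quasiSupport (hΔ : Measurable fun z : X × Y => Δ z.1 z.2)
    (hQ : AnalyticSet {z : X × ProbabilityMeasure Y | z.2 ∈ Q z.1}) {O : Set E}
    (hO : IsOpen O) : AnalyticSet {z : X × E | z.2 ∈ O ∧ z.2 ∈ quasiSupport (Δ z.1) (Q z.1)} := by
  have : ProperSpace E := FiniteDimensional.proper ℝ E
  have hΔx : ∀ x, Measurable (Δ x) := fun x => hΔ.comp measurable_prodMk_left
  have hA : AnalyticSet {z : (X × E) × ProbabilityMeasure Y | z.2 ∈ Q z.1.1} := by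
    rcases Set.eq_empty_or_nonempty {z : X × ProbabilityMeasure Y | z.2 ∈ Q z.1} with h0 | h0
    · convert analyticSet_empty
      ext z
      have : (z.1.1, z.2) ∉ {z : X × ProbabilityMeasure Y | z.2 ∈ Q z.1} := by
        rw [h0]; exact notMem_empty _
      simpa using this
    rw [AnalyticSet] at hQ
    obtain ⟨f, hf, hfr⟩ := hQ.resolve_left h0.ne_empty
    have hcont : Continuous fun z : (ℕ → ℕ) × E => (((f z.1).1, z.2), (f z.1).2) := by fun_prop
    convert analyticSet_range_of_polishSpace hcont
    ext ⟨⟨x, y⟩, p⟩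
    constructor
    · intro h
      have : (x, p) ∈ range f := by rw [hfr]; exact h
      obtain ⟨a, ha⟩ := this
      exact ⟨(a, y), by simp [ha]⟩
    · rintro ⟨⟨a, y'⟩, ha⟩
      have hmem : f a ∈ {z : X × ProbabilityMeasure Y | z.2 ∈ Q z.1} := hfr ▸ mem_range_self a
      simp only [Prod.mk.injEq] at ha
      obtain ⟨⟨h1, -⟩, h2⟩ := ha
      rw [← h1, ← h2]
      exact hmem
  have hn : ∀ n : ℕ, AnalyticSet {z : X × E | z.2 ∈ O ∧ ∃ p ∈ Q z.1,
      0 < (p : Measure Y) {w | Δ z.1 w ∈ Metric.ball z.2 (1 / ((n : ℝ) + 1))}} := by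
    intro n
    have hV : MeasurableSet {v : (X × E) × Y |
        v.1.2 ∈ O ∧ dist (Δ v.1.1 v.2) v.1.2 < 1 / ((n : ℝ) + 1)} := by
      have hdist : Measurable fun v : (X × E) × Y => dist (Δ v.1.1 v.2) v.1.2 :=
        (hΔ.comp ((measurable_fst.comp measurable_fst).prodMk measurable_snd)).dist
          (measurable_snd.comp measurable_fst)
      exact MeasurableSet.inter ((measurable_snd.comp measurable_fst) hO.measurableSet)
        (measurableSet_lt hdist measurable_const)
    convert (hA.setOf_measure_pos hV).image_of_continuous continuous_fst using 1
    ext ⟨x, y⟩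
    constructor
    · rintro ⟨hy, p, hp, hpos⟩
      refine ⟨((x, y), p), ⟨hp, ?_⟩, rfl⟩
      refine hpos.trans_le (measure_mono fun w hw => ⟨hy, hw⟩)
    · rintro ⟨⟨_, p⟩, ⟨hp, hpos⟩, rfl⟩
      obtain ⟨w, hw⟩ := nonempty_of_measure_ne_zero hpos.ne'
      exact ⟨hw.1, p, hp, hpos.trans_le (measure_mono fun w hw => hw.2)⟩
  convert AnalyticSet.iInter hn using 1
  ext ⟨x, y⟩
  simp only [mem_iInter]
  constructor
  · rintro ⟨hy, hyD⟩ n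
    exact ⟨hy, (mem_quasiSupport_iff (hΔx x)).1 hyD _ (by positivity)⟩
  · intro h
    refine ⟨(h 0).1, (mem_quasiSupport_iff (hΔx x)).2 fun ε hε => ?_⟩
    obtain ⟨n, hn⟩ := exists_nat_one_div_lt hε
    obtain ⟨p, hp, hpos⟩ := (h n).2
    exact ⟨p, hp, hpos.trans_le (measure_mono fun w hw => Metric.ball_subset_ball hn.le hw)⟩

/-- The support has a Castaing representation: a sequence of universally measurable selections
that is dense in the support at each history. -/
theorem exists_castaing (hΔ : Measurable fun z : X × Y => Δ z.1 z.2)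
    (hQ : AnalyticSet {z : X × ProbabilityMeasure Y | z.2 ∈ Q z.1})
    (hne : ∀ x, (Q x).Nonempty) :
    ∃ f : ℕ → X → E, (∀ n, UnivMeasurable (f n)) ∧
      (∀ x n, f n x ∈ quasiSupport (Δ x) (Q x)) ∧
      ∀ x, quasiSupport (Δ x) (Q x) ⊆ closure (range fun n => f n x) := by
  have : ProperSpace E := FiniteDimensional.proper ℝ E
  have hΔx : ∀ x, Measurable (Δ x) := fun x => hΔ.comp measurable_prodMk_left
  have hE : (inferInstance : MeasurableSpace E) ≤ borel E := BorelSpace.measurable_eq.le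
  obtain ⟨f₀, hf₀, hf₀D, -⟩ := (analyticSet_quasiSupport hΔ hQ isOpen_univ).exists_univMeasurable hE
    (h := fun _ => (0 : E)) measurable_const.univMeasurable
  have hf₀D' : ∀ x, f₀ x ∈ quasiSupport (Δ x) (Q x) := fun x => by
    obtain ⟨y, hy⟩ := quasiSupport_nonempty (hΔx x) (hne x)
    exact (hf₀D x ⟨(x, y), ⟨mem_univ y, hy⟩, rfl⟩).2
  -- `g i` selects from the part of the support in the ball `B i`, and equals `f₀` if it is empty
  let B : ℕ × ℕ → Set E := fun i => Metric.ball (TopologicalSpace.denseSeq E i.1) (1 / (i.2 + 1))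
  have hB : ∀ i, IsOpen (B i) := fun i => Metric.isOpen_ball
  choose g hg hgD hg0 using fun i =>
    (analyticSet_quasiSupport hΔ hQ (hB i)).exists_univMeasurable hE hf₀
  have hgmem : ∀ i x, g i x ∈ quasiSupport (Δ x) (Q x) := fun i x => by
    by_cases hx : x ∈ Prod.fst '' {z : X × E | z.2 ∈ B i ∧ z.2 ∈ quasiSupport (Δ z.1) (Q z.1)}
    · exact (hgD i x hx).2
    · rw [hg0 i x hx]
      exact hf₀D' x
  refine ⟨fun n => g n.unpair, fun n => hg _, fun x n => hgmem _ x, fun x y hy => ?_⟩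
  refine Metric.mem_closure_iff.2 fun ε hε => ?_
  obtain ⟨m, hm⟩ := exists_nat_one_div_lt (half_pos hε)
  obtain ⟨l, hl⟩ := (TopologicalSpace.denseRange_denseSeq E).exists_dist_lt y
    (ε := 1 / ((m : ℝ) + 1)) (by positivity)
  have h1 := (hgD (l, m) x ⟨(x, y), ⟨hl, hy⟩, rfl⟩).1
  refine ⟨g (l, m) x, ⟨Nat.pair l m, by simp⟩, ?_⟩
  have h1' : dist (g (l, m) x) (TopologicalSpace.denseSeq E l) < 1 / ((m : ℝ) + 1) := h1
  calc dist y (g (l, m) x)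
      ≤ dist y (TopologicalSpace.denseSeq E l) +
          dist (g (l, m) x) (TopologicalSpace.denseSeq E l) := dist_triangle_right _ _ _
    _ < ε := by linarith

end Castaing

section Rational

variable {E : Type*} [NormedAddCommGroup E] [InnerProductSpace ℝ E]

/-- The linear combination of the sequence `f` with rational coefficients `c`. -/
noncomputable def ratComb (f : ℕ → E) (c : ℕ →₀ ℚ) : E := c.sum fun i a => (a : ℝ) • f i

theorem ratComb_mem_span (f : ℕ → E) (c : ℕ →₀ ℚ) :
    ratComb f c ∈ Submodule.span ℝ (range f) :=
  Submodule.sum_mem _ fun i _ => Submodule.smul_mem _ _ (Submodule.subset_span (mem_range_self i))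

theorem span_subset_closure_ratComb (f : ℕ → E) :
    (Submodule.span ℝ (range f) : Set E) ⊆ closure (range (ratComb f)) := by
  intro y hy
  induction hy using Submodule.span_induction with
  | mem y hy =>
    obtain ⟨i, rfl⟩ := hy
    exact subset_closure ⟨Finsupp.single i 1, by simp [ratComb]⟩
  | zero => exact subset_closure ⟨0, by simp [ratComb]⟩
  | add y z _ _ hy hz =>
    refine map_mem_closure₂ continuous_add hy hz ?_
    rintro _ ⟨c, rfl⟩ _ ⟨c', rfl⟩
    refine ⟨c + c', ?_⟩
    exact Finsupp.sum_add_index' (by simp) (by intros; push_cast; rw [add_smul])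
  | smul a y _ hy =>
    refine map_mem_closure₂ continuous_smul (Rat.denseRange_cast a) hy ?_
    rintro _ ⟨q, rfl⟩ _ ⟨c, rfl⟩
    refine ⟨q • c, ?_⟩
    rw [ratComb, ratComb, Finsupp.sum_smul_index' (by simp), Finsupp.smul_sum]
    simp [mul_smul]

theorem dominates_iff_ratComb [TopologicalSpace.SeparableSpace E] (f : ℕ → E) (k : ℕ) :
    Dominates f k ↔ ∀ (i : ℕ) (c : ℕ →₀ ℚ), ∃ n ≤ k,
      inner ℝ (TopologicalSpace.denseSeq E i) (ratComb f c) ≤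
        (k + 1) * ‖ratComb f c‖ * inner ℝ (TopologicalSpace.denseSeq E i) (f n) := by
  refine ⟨fun h i c => h _ _ (ratComb_mem_span f c), fun h v g hg => ?_⟩
  have hcl : IsClosed (⋃ n ∈ Iic k,
      {z : E × E | inner ℝ z.1 z.2 ≤ (k + 1) * ‖z.2‖ * inner ℝ z.1 (f n)}) :=
    (finite_Iic k).isClosed_biUnion fun n _ => isClosed_le
      (continuous_fst.inner continuous_snd)
      ((continuous_const.mul continuous_snd.norm).mul (continuous_fst.inner continuous_const))
  have hmem : (v, g) ∈ closure
      (range (TopologicalSpace.denseSeq E) ×ˢ range (ratComb f)) := by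
    rw [closure_prod_eq]
    exact ⟨TopologicalSpace.denseRange_denseSeq E v, span_subset_closure_ratComb f hg⟩
  have := closure_minimal (t := ⋃ n ∈ Iic k,
      {z : E × E | inner ℝ z.1 z.2 ≤ (k + 1) * ‖z.2‖ * inner ℝ z.1 (f n)}) ?_ hcl hmem
  · simp only [mem_iUnion] at this
    obtain ⟨n, hn, hle⟩ := this
    exact ⟨n, hn, hle⟩
  · rintro ⟨_, _⟩ ⟨⟨i, rfl⟩, ⟨c, rfl⟩⟩
    obtain ⟨n, hn, hle⟩ := h i c
    exact mem_biUnion (x := n) hn hle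

theorem measurableSet_dominates [FiniteDimensional ℝ E] [MeasurableSpace E] [BorelSpace E]
    {X : Type*} {m : MeasurableSpace X} {f : ℕ → X → E} (hf : ∀ n, Measurable (f n)) (k : ℕ) :
    MeasurableSet {x | Dominates (fun n => f n x) k} := by
  have : ProperSpace E := FiniteDimensional.proper ℝ E
  have hcomb : ∀ c, Measurable fun x => ratComb (fun n => f n x) c := fun c =>
    Finset.measurable_fun_sum _ fun i _ => (hf i).const_smul _
  have heq : {x | Dominates (fun n => f n x) k} = ⋂ (i : ℕ), ⋂ (c : ℕ →₀ ℚ), ⋃ n ∈ Iic k,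
      {x | inner ℝ (TopologicalSpace.denseSeq E i) (ratComb (fun n => f n x) c) ≤
        (k + 1) * ‖ratComb (fun n => f n x) c‖ *
          inner ℝ (TopologicalSpace.denseSeq E i) (f n x)} := by
    ext x
    simp only [mem_iInter, mem_iUnion]
    refine (dominates_iff_ratComb _ k).trans (forall₂_congr fun i c => exists_congr fun n => ?_)
    exact ⟨fun h => ⟨h.1, h.2⟩, fun ⟨h1, h2⟩ => ⟨h1, h2⟩⟩
  rw [heq]
  refine MeasurableSet.iInter fun i => MeasurableSet.iInter fun c =>
    MeasurableSet.biUnion (to_countable _) fun n _ => measurableSet_le ?_ ?_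
  · exact measurable_const.inner (hcomb c)
  · exact (measurable_const.mul (hcomb c).norm).mul (measurable_const.inner (hf n))

end Rational

/-! ### Products of measures with universally measurable kernels -/

section Kernels

variable {Ω : ℕ → Type u}

instance Hist.instBorelSpace [∀ t, TopologicalSpace (Ω t)] [∀ t, PolishSpace (Ω t)]
    [∀ t, MeasurableSpace (Ω t)] [∀ t, BorelSpace (Ω t)] : ∀ t, BorelSpace (Hist Ω t)
  | 0 => inferInstanceAs (BorelSpace PUnit)
  | t + 1 =>
    have := Hist.instBorelSpace t
    inferInstanceAs (BorelSpace (Hist Ω t × Ω t))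

instance Hist.instPolishSpace [∀ t, TopologicalSpace (Ω t)] [∀ t, PolishSpace (Ω t)] :
    ∀ t, PolishSpace (Hist Ω t)
  | 0 => inferInstanceAs (PolishSpace PUnit)
  | t + 1 =>
    have := Hist.instPolishSpace t
    inferInstanceAs (PolishSpace (Hist Ω t × Ω t))

variable [∀ t, MeasurableSpace (Ω t)] {t : ℕ}

theorem Hist.measurable_fst : Measurable fun ω : Hist Ω (t + 1) => (ω.1 : Hist Ω t) :=
  _root_.measurable_fst (α := Hist Ω t) (β := Ω t)

theorem Hist.measurable_snoc : Measurable fun z : Hist Ω t × Ω t => Hist.snoc z.1 z.2 :=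
  measurable_id (α := Hist Ω t × Ω t)

theorem UnivMeasurable.isUnivKernel {q : Hist Ω t → ProbabilityMeasure (Ω t)}
    (hq : UnivMeasurable q) : IsUnivKernel q := fun _ hB =>
  ((Measure.measurable_coe hB).comp measurable_subtype_coe).comp_univMeasurable hq

theorem IsUnivKernel.univMeasurable_section {q : Hist Ω t → ProbabilityMeasure (Ω t)}
    (hq : IsUnivKernel q) {A : Set (Hist Ω (t + 1))} (hA : MeasurableSet A) :
    UnivMeasurable fun ω => (q ω : Measure (Ω t)) {w | Hist.snoc ω w ∈ A} := by
  have hA' : MeasurableSet {z : Hist Ω t × Ω t | Hist.snoc z.1 z.2 ∈ A} := Hist.measurable_snoc hA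
  -- `q` is a kernel in the sense of Mathlib if the histories carry the universal sigma-algebra
  have hle : (inferInstance : MeasurableSpace (Hist Ω t × Ω t)) ≤
      @Prod.instMeasurableSpace _ _ (universalSigma (Hist Ω t)) _ :=
    sup_le_sup (MeasurableSpace.comap_mono le_universalSigma) le_rfl
  let κ : @ProbabilityTheory.Kernel (Hist Ω t) (Ω t) (universalSigma (Hist Ω t)) _ :=
    @ProbabilityTheory.Kernel.mk _ _ (universalSigma (Hist Ω t)) _
      (fun ω => (q ω : Measure (Ω t))) (@Measure.measurable_of_measurable_coe _ _ _
        (universalSigma (Hist Ω t)) _ fun B hB => hq B hB)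
  have : @ProbabilityTheory.IsMarkovKernel _ _ (universalSigma (Hist Ω t)) _ κ :=
    @ProbabilityTheory.IsMarkovKernel.mk _ _ (universalSigma (Hist Ω t)) _ κ fun ω =>
      inferInstanceAs (IsProbabilityMeasure (q ω : Measure (Ω t)))
  exact @ProbabilityTheory.Kernel.measurable_kernel_prodMk_left _ _ (universalSigma (Hist Ω t)) _
    κ _ _ (hle _ hA')

theorem exists_isKernelProduct (P : ProbabilityMeasure (Hist Ω t))
    {q : Hist Ω t → ProbabilityMeasure (Ω t)} (hq : IsUnivKernel q) :
    ∃ P', IsKernelProduct P q P' := by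
  let μ : Measure (Hist Ω (t + 1)) := Measure.ofMeasurable
    (fun A _ => ∫⁻ ω, (q ω : Measure (Ω t)) {w | Hist.snoc ω w ∈ A} ∂(P : Measure (Hist Ω t)))
    (by simp) (by
      intro A hA hdisj
      rw [← lintegral_tsum fun n => (hq.univMeasurable_section (hA n)).aemeasurable P]
      refine lintegral_congr fun ω => ?_
      have : {w | Hist.snoc ω w ∈ ⋃ n, A n} = ⋃ n, {w | Hist.snoc ω w ∈ A n} :=
        preimage_iUnion (f := Hist.snoc ω)
      rw [this]
      refine measure_iUnion (fun i j hij => ?_) fun n => ?_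
      · exact (hdisj hij).preimage (Hist.snoc ω)
      · exact (Hist.measurable_snoc.comp measurable_prodMk_left) (hA n))
  have hμ : ∀ A, MeasurableSet A → μ A =
      ∫⁻ ω, (q ω : Measure (Ω t)) {w | Hist.snoc ω w ∈ A} ∂(P : Measure (Hist Ω t)) :=
    fun A hA => Measure.ofMeasurable_apply A hA
  have hprob : IsProbabilityMeasure μ := ⟨by
    rw [hμ univ MeasurableSet.univ]
    simp⟩
  exact ⟨⟨μ, hprob⟩, hμ⟩

/-- Here `N` is arbitrary and `P' N` is an outer measure. -/
theorem IsKernelProduct.ae_section_null {P : ProbabilityMeasure (Hist Ω t)}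
    {q : Hist Ω t → ProbabilityMeasure (Ω t)} {P' : ProbabilityMeasure (Hist Ω (t + 1))}
    (h : IsKernelProduct P q P') (hq : IsUnivKernel q) {N : Set (Hist Ω (t + 1))}
    (hN : (P' : Measure (Hist Ω (t + 1))) N = 0) :
    ∀ᵐ ω ∂(P : Measure (Hist Ω t)), (q ω : Measure (Ω t)) {w | Hist.snoc ω w ∈ N} = 0 := by
  have hmeas := measurableSet_toMeasurable (P' : Measure (Hist Ω (t + 1))) N
  have h0 := h _ hmeas
  rw [measure_toMeasurable, hN, eq_comm,
    lintegral_eq_zero_iff' ((hq.univMeasurable_section hmeas).aemeasurable P)] at h0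
  filter_upwards [h0] with ω hω
  exact measure_mono_null (fun w hw => subset_toMeasurable _ N hw) hω

theorem IsKernelProduct.null_of_ae {P : ProbabilityMeasure (Hist Ω t)}
    {q : Hist Ω t → ProbabilityMeasure (Ω t)} {P' : ProbabilityMeasure (Hist Ω (t + 1))}
    (h : IsKernelProduct P q P') {N : Set (Hist Ω (t + 1))} (hN : MeasurableSet N)
    (h0 : ∀ᵐ ω ∂(P : Measure (Hist Ω t)), (q ω : Measure (Ω t)) {w | Hist.snoc ω w ∈ N} = 0) :
    (P' : Measure (Hist Ω (t + 1))) N = 0 := by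
  rw [h N hN]
  exact lintegral_eq_zero_of_ae_eq_zero h0

variable {Q : (t : ℕ) → Hist Ω t → Set (ProbabilityMeasure (Ω t))}

theorem IsPolar.preimage_fst {N : Set (Hist Ω t)} (hN : IsPolar (priors Q t) N) :
    IsPolar (priors Q (t + 1)) {ω | ω.1 ∈ N} := by
  rintro P' ⟨P, hP, q, -, -, hPq⟩
  have hmeas := measurableSet_toMeasurable (P : Measure (Hist Ω t)) N
  refine measure_mono_null
    (t := {ω : Hist Ω (t + 1) | ω.1 ∈ toMeasurable (P : Measure (Hist Ω t)) N})
    (fun ω hω => subset_toMeasurable _ N hω) ?_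
  refine hPq.null_of_ae (Hist.measurable_fst hmeas) ?_
  have : ∀ᵐ ω ∂(P : Measure (Hist Ω t)), ω ∉ toMeasurable (P : Measure (Hist Ω t)) N := by
    rw [← measure_eq_zero_iff_ae_notMem, measure_toMeasurable]
    exact hN P hP
  filter_upwards [this] with ω hω
  refine measure_mono_null (t := ∅) (fun w hw => ?_) measure_empty
  exact hω hw

theorem IsPolar.of_preimage_fst {N : Set (Hist Ω t)}
    (hq : ∃ q : Hist Ω t → ProbabilityMeasure (Ω t), IsUnivKernel q ∧ ∀ ω, q ω ∈ Q t ω)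
    (hN : IsPolar (priors Q (t + 1)) {ω | ω.1 ∈ N}) : IsPolar (priors Q t) N := by
  intro P hP
  obtain ⟨q, hq, hqQ⟩ := hq
  obtain ⟨P', hP'⟩ := exists_isKernelProduct P hq
  have h0 := hP'.ae_section_null hq (hN P' ⟨P, hP, q, hq, hqQ, hP'⟩)
  rw [measure_eq_zero_iff_ae_notMem]
  filter_upwards [h0] with ω hω hωN
  have huniv : (q ω : Measure (Ω t)) univ = 0 := measure_mono_null (fun w _ => hωN) hω
  rw [measure_univ] at huniv
  exact one_ne_zero huniv

end Kernels

/-! ### Strategies that trade in a single period -/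

section Strategy

variable {Ω : ℕ → Type u} {d : ℕ} (S : (t : ℕ) → Hist Ω t → EuclideanSpace ℝ (Fin d)) {t : ℕ}
  (φ : Hist Ω t → EuclideanSpace ℝ (Fin d))

/-- The strategy that holds `φ` during the period after `t` and nothing otherwise. -/
noncomputable def singlePeriod (s : ℕ) : Hist Ω s → EuclideanSpace ℝ (Fin d) :=
  Function.update (fun _ _ => 0 : (s : ℕ) → Hist Ω s → EuclideanSpace ℝ (Fin d)) t φ s

theorem singlePeriod_self : singlePeriod φ t = φ :=
  Function.update_self ..

theorem singlePeriod_of_ne {s : ℕ} (hs : s ≠ t) : singlePeriod φ s = fun _ => 0 :=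
  Function.update_of_ne hs ..

theorem portfolioValue_singlePeriod_of_le {s : ℕ} (hs : s ≤ t) (ω : Hist Ω s) :
    portfolioValue S (singlePeriod φ) s ω = 0 := by
  induction s with
  | zero => rfl
  | succ s ih =>
    rw [portfolioValue, ih (Nat.le_of_succ_le hs), singlePeriod_of_ne φ (by omega)]
    simp

theorem portfolioValue_singlePeriod_succ_self (ω : Hist Ω (t + 1)) :
    portfolioValue S (singlePeriod φ) (t + 1) ω = inner ℝ (φ ω.1) (increment S t ω.1 ω.2) := by
  rw [portfolioValue, portfolioValue_singlePeriod_of_le S φ le_rfl, singlePeriod_self, zero_add]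

theorem portfolioValue_singlePeriod_succ {s : ℕ} (hs : t < s) (ω : Hist Ω (s + 1)) :
    portfolioValue S (singlePeriod φ) (s + 1) ω = portfolioValue S (singlePeriod φ) s ω.1 := by
  rw [portfolioValue, singlePeriod_of_ne φ hs.ne']
  simp

variable [∀ t, MeasurableSpace (Ω t)] {Q : (t : ℕ) → Hist Ω t → Set (ProbabilityMeasure (Ω t))}
  {T : ℕ}

/-- A quasi-sure property of the terminal value of a single-period strategy can be decided at the
end of that period. -/
theorem qs_portfolioValue_singlePeriod_iff
    (hq : ∀ s < T, ∃ q : Hist Ω s → ProbabilityMeasure (Ω s), IsUnivKernel q ∧ ∀ ω, q ω ∈ Q s ω)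
    (R : ℝ → Prop) {s : ℕ} (hs : t + 1 ≤ s) (hsT : s ≤ T) :
    QS (priors Q s) (fun ω => R (portfolioValue S (singlePeriod φ) s ω)) ↔
      QS (priors Q (t + 1)) (fun ω => R (portfolioValue S (singlePeriod φ) (t + 1) ω)) := by
  induction s, hs using Nat.le_induction with
  | base => rfl
  | succ s hs ih =>
    rw [← ih (by omega)]
    simp only [QS, portfolioValue_singlePeriod_succ S φ hs]
    exact ⟨fun h => h.of_preimage_fst (hq s (by omega)), fun h => h.preimage_fst⟩

end Strategy

/-! ### No-arbitrage excludes half-spaces -/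

section NoArbitrage

theorem exists_measurableSet_of_ae {X : Type*} [MeasurableSpace X] {μ : Measure X} {p : X → Prop}
    (h : ∀ᵐ x ∂μ, p x) : ∃ B, MeasurableSet B ∧ (∀ᵐ x ∂μ, x ∈ B) ∧ ∀ x ∈ B, p x := by
  refine ⟨(toMeasurable μ {x | ¬ p x})ᶜ, (measurableSet_toMeasurable _ _).compl, ?_,
    fun x hx => ?_⟩
  · have : μ (toMeasurable μ {x | ¬ p x}) = 0 := by rw [measure_toMeasurable]; exact h
    exact measure_eq_zero_iff_ae_notMem.1 this
  · by_contra hp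
    exact hx (subset_toMeasurable _ _ hp)

theorem exists_univMeasurable_mem_of_analyticSet {X Y : Type*} [TopologicalSpace X]
    [PolishSpace X] [MeasurableSpace X] [BorelSpace X] [TopologicalSpace Y] [PolishSpace Y]
    [MeasurableSpace Y] [BorelSpace Y] {Q : X → Set (ProbabilityMeasure Y)}
    (hQ : AnalyticSet {z : X × ProbabilityMeasure Y | z.2 ∈ Q z.1}) (hne : ∀ x, (Q x).Nonempty) :
    ∃ q : X → ProbabilityMeasure Y, UnivMeasurable q ∧ ∀ x, q x ∈ Q x := by
  rcases isEmpty_or_nonempty X with hX | ⟨⟨x₀⟩⟩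
  · refine ⟨fun x => (hne x).some, ?_, fun x => (hne x).some_mem⟩
    intro s _
    rw [eq_empty_of_isEmpty ((fun x => (hne x).some) ⁻¹' s)]
    exact @MeasurableSet.empty _ (universalSigma X)
  · obtain ⟨q, hq, hqQ, -⟩ := hQ.exists_univMeasurable
      probabilityMeasure_measurableSpace_le_borel (h := fun _ => (hne x₀).some)
      measurable_const.univMeasurable
    exact ⟨q, hq, fun x => hqQ x ⟨(x, (hne x).some), (hne x).some_mem, rfl⟩⟩

/-- A measurable choice of directions that the sets `D x` never oppose and that, `P`-almost
everywhere where the half-space condition fails, separate `0` strictly from a point of the dense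
sequence. -/
theorem exists_separating_direction {X E : Type*} [TopologicalSpace X] [PolishSpace X]
    [MeasurableSpace X] [BorelSpace X] [NormedAddCommGroup E] [InnerProductSpace ℝ E]
    [FiniteDimensional ℝ E] [MeasurableSpace E] [BorelSpace E] {D : X → Set E} {f : ℕ → X → E}
    (hf : ∀ n, UnivMeasurable (f n)) (hfD : ∀ x, D x ⊆ closure (range fun n => f n x))
    (P : ProbabilityMeasure X) :
    ∃ φ : X → E, UnivMeasurable φ ∧ (∀ x, ∀ y ∈ D x, 0 ≤ inner ℝ (φ x) y) ∧
      ∀ᵐ x ∂(P : Measure X), ¬ NoHalfSpace (D x) → (∀ n, f n x ∈ D x) →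
        ∃ n, 0 < inner ℝ (φ x) (f n x) := by
  have : ProperSpace E := FiniteDimensional.proper ℝ E
  -- on `B` the selections `f n` agree with Borel functions `g n`
  let g : ℕ → X → E := fun n => ((hf n).aemeasurable P).mk (f n)
  have hg : ∀ n, Measurable (g n) := fun n => ((hf n).aemeasurable P).measurable_mk
  obtain ⟨B, hB, hBae, hBfg⟩ := exists_measurableSet_of_ae
    (ae_all_iff.2 fun n => ((hf n).aemeasurable P).ae_eq_mk)
  have hin : ∀ n, Measurable fun z : X × E => inner ℝ z.2 (g n z.1) := fun n =>
    measurable_snd.inner ((hg n).comp measurable_fst)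
  have hZ : MeasurableSet {z : X × E | z.1 ∈ B ∧ (∀ n, 0 ≤ inner ℝ z.2 (g n z.1)) ∧
      ∃ n, 0 < inner ℝ z.2 (g n z.1)} := by
    have h1 : MeasurableSet {z : X × E | ∀ n, 0 ≤ inner ℝ z.2 (g n z.1)} := by
      rw [ofPred_forall]
      exact MeasurableSet.iInter fun n => measurableSet_le measurable_const (hin n)
    have h2 : MeasurableSet {z : X × E | ∃ n, 0 < inner ℝ z.2 (g n z.1)} := by
      rw [ofPred_exists]
      exact MeasurableSet.iUnion fun n => measurableSet_lt measurable_const (hin n)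
    exact (measurable_fst hB).inter (h1.inter h2)
  obtain ⟨φ, hφ, hφZ, hφ0⟩ := hZ.analyticSet.exists_univMeasurable
    (BorelSpace.measurable_eq (α := E)).le (h := fun _ => 0) measurable_const.univMeasurable
  refine ⟨φ, hφ, fun x y hy => ?_, ?_⟩
  · by_cases hx : x ∈ Prod.fst '' {z : X × E | z.1 ∈ B ∧ (∀ n, 0 ≤ inner ℝ z.2 (g n z.1)) ∧
      ∃ n, 0 < inner ℝ z.2 (g n z.1)}
    · obtain ⟨hxB, hge, -⟩ := hφZ x hx
      have hcl : IsClosed {y | 0 ≤ inner ℝ (φ x) y} :=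
        isClosed_le continuous_const (continuous_const.inner continuous_id)
      refine closure_minimal (range_subset_iff.2 fun n => ?_) hcl (hfD x hy)
      change 0 ≤ inner ℝ (φ x) (f n x)
      rw [hBfg x hxB n]
      exact hge n
    · rw [hφ0 x hx, inner_zero_left]
  · filter_upwards [hBae] with x hxB hxH hxf
    simp only [NoHalfSpace, not_forall] at hxH
    obtain ⟨h, hh, y, hy, hne⟩ := hxH
    have hpos : ∃ n, 0 < inner ℝ h (f n x) := by
      by_contra! hcon
      have hcl : IsClosed {y | inner ℝ h y ≤ 0} :=
        isClosed_le (continuous_const.inner continuous_id) continuous_const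
      exact hne (le_antisymm (closure_minimal (range_subset_iff.2 hcon) hcl (hfD x hy)) (hh y hy))
    have hxZ : x ∈ Prod.fst '' {z : X × E | z.1 ∈ B ∧ (∀ n, 0 ≤ inner ℝ z.2 (g n z.1)) ∧
        ∃ n, 0 < inner ℝ z.2 (g n z.1)} := by
      refine ⟨(x, h), ⟨hxB, fun n => ?_, ?_⟩, rfl⟩
      · have := hh _ (hxf n)
        rwa [hBfg x hxB n] at this
      · obtain ⟨n, hn⟩ := hpos
        exact ⟨n, by rwa [hBfg x hxB n] at hn⟩
    obtain ⟨-, -, n, hn⟩ := hφZ x hxZ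
    exact ⟨n, by rw [hBfg x hxB n]; exact hn⟩

variable {Ω : ℕ → Type u} [∀ t, MeasurableSpace (Ω t)] {T d : ℕ}
  {S : (t : ℕ) → Hist Ω t → EuclideanSpace ℝ (Fin d)}
  {Q : (t : ℕ) → Hist Ω t → Set (ProbabilityMeasure (Ω t))}

theorem AdaptedPrices.measurable_increment (hS : AdaptedPrices T S) {t : ℕ} (ht : t < T) :
    Measurable fun z : Hist Ω t × Ω t => increment S t z.1 z.2 :=
  ((hS (t + 1) ht).comp Hist.measurable_snoc).sub ((hS t ht.le).comp measurable_fst)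

/-- Trading into a direction that the support does not oppose produces no losses. -/
theorem qs_inner_increment_nonneg (hS : AdaptedPrices T S) {t : ℕ} (ht : t < T)
    {φ : Hist Ω t → EuclideanSpace ℝ (Fin d)} (hφ : UnivMeasurable φ)
    (hφD : ∀ ω, ∀ y ∈ condSupport S Q t ω, 0 ≤ inner ℝ (φ ω) y) :
    QS (priors Q (t + 1)) fun ω => 0 ≤ inner ℝ (φ ω.1) (increment S t ω.1 ω.2) := by
  rintro P' ⟨P, -, q, -, hqQ, hP'⟩
  have hΔ := hS.measurable_increment ht
  obtain ⟨B, hB, hBae, hBφ⟩ := exists_measurableSet_of_ae (hφ.aemeasurable P).ae_eq_mk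
  set ψ := (hφ.aemeasurable P).mk φ
  have hψ : Measurable ψ := (hφ.aemeasurable P).measurable_mk
  have hlt : Measurable fun z : Hist Ω t × Ω t => inner ℝ (ψ z.1) (increment S t z.1 z.2) :=
    (hψ.comp measurable_fst).inner hΔ
  have hV : MeasurableSet
      {z : Hist Ω t × Ω t | z.1 ∉ B ∨ inner ℝ (ψ z.1) (increment S t z.1 z.2) < 0} :=
    MeasurableSet.union (measurable_fst hB.compl) (measurableSet_lt hlt measurable_const)
  refine measure_mono_null ?_ (hP'.null_of_ae (N := {ω : Hist Ω (t + 1) | ω.1 ∉ B ∨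
    inner ℝ (ψ ω.1) (increment S t ω.1 ω.2) < 0}) hV ?_)
  · intro ω (hω : ¬ 0 ≤ inner ℝ (φ ω.1) (increment S t ω.1 ω.2))
    by_cases hωB : ω.1 ∈ B
    · right
      rw [← hBφ _ hωB]
      exact not_le.1 hω
    · exact Or.inl hωB
  · filter_upwards [hBae] with ω hωB
    have hΔω : Measurable (increment S t ω) := hΔ.comp measurable_prodMk_left
    refine measure_mono_null ?_ (ae_mem_quasiSupport hΔω (hqQ ω))
    intro w (hw : ω ∉ B ∨ inner ℝ (ψ ω) (increment S t ω w) < 0) hwD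
    have h1 := hw.resolve_left (not_not.2 hωB)
    rw [← hBφ ω hωB] at h1
    exact absurd (hφD ω _ hwD) (not_le.2 h1)

variable [∀ t, TopologicalSpace (Ω t)] [∀ t, PolishSpace (Ω t)] [∀ t, BorelSpace (Ω t)]

theorem PriorAssumption.exists_univMeasurable (hQ : PriorAssumption T Q) {t : ℕ} (ht : t < T) :
    ∃ q : Hist Ω t → ProbabilityMeasure (Ω t), UnivMeasurable q ∧ ∀ ω, q ω ∈ Q t ω :=
  exists_univMeasurable_mem_of_analyticSet (hQ.analytic t ht) (hQ.nonempty t ht)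

/-- The one-step extension of a prior can be chosen to charge the gains of a strategy at
`P`-almost all histories at which some one-period prior charges them. -/
theorem exists_prior_charging (hS : AdaptedPrices T S) (hQ : PriorAssumption T Q) {t : ℕ}
    (ht : t < T) {φ : Hist Ω t → EuclideanSpace ℝ (Fin d)} (hφ : UnivMeasurable φ)
    {P : ProbabilityMeasure (Hist Ω t)} (hP : P ∈ priors Q t) :
    ∃ P' ∈ priors Q (t + 1), ∀ N : Set (Hist Ω (t + 1)),
      (∀ ω : Hist Ω (t + 1), 0 < inner ℝ (φ ω.1) (increment S t ω.1 ω.2) → ω ∈ N) →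
      (P' : Measure (Hist Ω (t + 1))) N = 0 →
      ∀ᵐ ω ∂(P : Measure (Hist Ω t)), ∀ p ∈ Q t ω,
        (p : Measure (Ω t)) {w | 0 < inner ℝ (φ ω) (increment S t ω w)} = 0 := by
  have hΔ := hS.measurable_increment ht
  have hφψ := (hφ.aemeasurable P).ae_eq_mk
  set ψ := (hφ.aemeasurable P).mk φ
  have hψ : Measurable ψ := (hφ.aemeasurable P).measurable_mk
  have hV : MeasurableSet
      {z : Hist Ω t × Ω t | 0 < inner ℝ (ψ z.1) (increment S t z.1 z.2)} :=
    measurableSet_lt measurable_const ((hψ.comp measurable_fst).inner hΔ)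
  obtain ⟨q₀, hq₀, hq₀Q⟩ := hQ.exists_univMeasurable ht
  obtain ⟨q, hq, hqA, hqq₀⟩ := ((hQ.analytic t ht).setOf_measure_pos hV).exists_univMeasurable
    probabilityMeasure_measurableSpace_le_borel hq₀
  have hqQ : ∀ ω, q ω ∈ Q t ω := fun ω => by
    by_cases hω : ω ∈ Prod.fst '' {z : Hist Ω t × ProbabilityMeasure (Ω t) |
        z ∈ {x : Hist Ω t × ProbabilityMeasure (Ω t) | x.2 ∈ Q t x.1} ∧
        0 < (z.2 : Measure (Ω t)) {w | (z.1, w) ∈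
          {z : Hist Ω t × Ω t | 0 < inner ℝ (ψ z.1) (increment S t z.1 z.2)}}}
    · exact (hqA ω hω).1
    · rw [hqq₀ ω hω]
      exact hq₀Q ω
  obtain ⟨P', hP'⟩ := exists_isKernelProduct P hq.isUnivKernel
  refine ⟨P', ⟨P, hP, q, hq.isUnivKernel, hqQ, hP'⟩, fun N hN hN0 => ?_⟩
  filter_upwards [hP'.ae_section_null hq.isUnivKernel hN0, hφψ] with ω hω hωψ p hp
  by_contra hne
  rw [hωψ] at hne
  have hpos := (hqA ω ⟨(ω, p), ⟨hp, pos_iff_ne_zero.2 hne⟩, rfl⟩).2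
  refine hpos.ne' (measure_mono_null (fun w hw => hN _ ?_) hω)
  have hw : 0 < inner ℝ (ψ ω) (increment S t ω w) := hw
  rw [← hωψ] at hw
  exact hw

theorem NoArbitrage.isFull_noHalfSpace (hNA : NoArbitrage T S Q) (hS : AdaptedPrices T S)
    (hQ : PriorAssumption T Q) {t : ℕ} (ht : t < T) :
    IsFull (priors Q t) {ω | NoHalfSpace (condSupport S Q t ω)} := by
  intro P hP
  have hΔ := hS.measurable_increment ht
  have hΔω : ∀ ω, Measurable (increment S t ω) := fun ω => hΔ.comp measurable_prodMk_left
  obtain ⟨f, hf, hfD, hDf⟩ := exists_castaing hΔ (hQ.analytic t ht) (hQ.nonempty t ht)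
  obtain ⟨φ, hφ, hφD, hφpos⟩ := exists_separating_direction hf hDf P
  have hsel : ∀ s < T, ∃ q : Hist Ω s → ProbabilityMeasure (Ω s),
      IsUnivKernel q ∧ ∀ ω, q ω ∈ Q s ω := fun s hs => by
    obtain ⟨q, hq, hqQ⟩ := hQ.exists_univMeasurable hs
    exact ⟨q, hq.isUnivKernel, hqQ⟩
  have hmeas : ∀ s < T, UnivMeasurable (singlePeriod φ s) := fun s _ => by
    rcases eq_or_ne s t with rfl | hst
    · rwa [singlePeriod_self]
    · rw [singlePeriod_of_ne φ hst]
      exact measurable_const.univMeasurable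
  have hzero := hNA (singlePeriod φ) hmeas
    ((qs_portfolioValue_singlePeriod_iff S φ hsel (fun x => 0 ≤ x) ht le_rfl).2 (by
      simp only [portfolioValue_singlePeriod_succ_self]
      exact qs_inner_increment_nonneg hS ht hφ hφD))
  rw [qs_portfolioValue_singlePeriod_iff S φ hsel (fun x => x = 0) ht le_rfl] at hzero
  simp only [portfolioValue_singlePeriod_succ_self] at hzero
  obtain ⟨P', hP', hcharge⟩ := exists_prior_charging hS hQ ht hφ hP
  have hae := hcharge _ (fun ω hω => hω.ne') (hzero P' hP')
  have : ∀ᵐ ω ∂(P : Measure (Hist Ω t)), NoHalfSpace (condSupport S Q t ω) := by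
    filter_upwards [hae, hφpos] with ω h0 hpos
    by_contra hω
    obtain ⟨n, hn⟩ := hpos hω (hfD ω)
    have hopen : IsOpen {y : EuclideanSpace ℝ (Fin d) | 0 < inner ℝ (φ ω) y} :=
      isOpen_lt continuous_const (continuous_const.inner continuous_id)
    obtain ⟨ε, hε, hball⟩ := Metric.isOpen_iff.1 hopen _ hn
    obtain ⟨p, hp, hppos⟩ := (mem_quasiSupport_iff (hΔω ω)).1 (hfD ω n) ε hε
    exact hppos.ne' (measure_mono_null (fun w hw => hball hw) (h0 p hp))
  exact this

end NoArbitrage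

/-! ### The conditions at a history -/

section Pointwise

variable {Ω : ℕ → Type u} [∀ t, MeasurableSpace (Ω t)] {d t : ℕ}
  {S : (t : ℕ) → Hist Ω t → EuclideanSpace ℝ (Fin d)}
  {Q : (t : ℕ) → Hist Ω t → Set (ProbabilityMeasure (Ω t))} {ω : Hist Ω t}
  {f : ℕ → EuclideanSpace ℝ (Fin d)} {k : ℕ}

theorem geomAt_iff_noHalfSpace (hf : ∀ n, f n ∈ condSupport S Q t ω)
    (hD : condSupport S Q t ω ⊆ closure (range f)) :
    GeomAt S Q t ω ↔ NoHalfSpace (condSupport S Q t ω) :=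
  mem_intrinsicInterior_iff_noHalfSpace hf hD

theorem isRadius_of_dominates (hf : ∀ n, f n ∈ condSupport S Q t ω)
    (hD : condSupport S Q t ω ⊆ closure (range f)) (hk : Dominates f k) :
    IsRadius S Q t ω (1 / ((k : ℝ) + 1)) :=
  ⟨by positivity, (inter_subset_inter_right _ affineSpan_subset_span).trans
    (hk.ball_inter_span_subset_convexHull hf hD)⟩

theorem isLossSize_of_dominates (hΔ : Measurable (increment S t ω))
    (hf : ∀ n, f n ∈ condSupport S Q t ω) (hD : condSupport S Q t ω ⊆ closure (range f))
    (hk : Dominates f k) : IsLossSize S Q t ω (1 / (4 * ((k : ℝ) + 1))) := by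
  obtain ⟨κ, hκ, h⟩ := hk.exists_loss hΔ hf hD
  refine ⟨⟨by positivity, ?_⟩, κ, hκ, fun v hv => h v (affineSpan_subset_span hv)⟩
  rw [div_lt_one (by positivity)]
  have : (0 : ℝ) ≤ k := k.cast_nonneg
  linarith

theorem quantAt_iff_noHalfSpace (hΔ : Measurable (increment S t ω)) (hQ : (Q t ω).Nonempty)
    (hf : ∀ n, f n ∈ condSupport S Q t ω) (hD : condSupport S Q t ω ⊆ closure (range f)) :
    QuantAt S Q t ω ↔ NoHalfSpace (condSupport S Q t ω) := by
  constructor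
  · rintro ⟨β, hβ, κ, hκ, h⟩
    exact noHalfSpace_of_loss hΔ hQ hβ.1 hκ.1 h
  · intro h
    obtain ⟨k, hk⟩ := exists_dominates h hf hD
    exact ⟨_, isLossSize_of_dominates hΔ hf hD hk⟩

end Pointwise

theorem IsPolar.mono {X : Type*} [MeasurableSpace X] {𝔐 : Set (ProbabilityMeasure X)}
    {M N : Set X} (hN : IsPolar 𝔐 N) (h : M ⊆ N) : IsPolar 𝔐 M :=
  fun P hP => measure_mono_null h (hN P hP)

end QuasiSure

open QuasiSure
theorem proposition3p12 {Ω : ℕ → Type*} [∀ t, TopologicalSpace (Ω t)] [∀ t, PolishSpace (Ω t)]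
    [∀ t, MeasurableSpace (Ω t)] [∀ t, BorelSpace (Ω t)] (T d : ℕ)
    (S : (t : ℕ) → Hist Ω t → EuclideanSpace ℝ (Fin d))
    (Q : (t : ℕ) → Hist Ω t → Set (ProbabilityMeasure (Ω t)))
    (hS : AdaptedPrices T S) (hQ : PriorAssumption T Q)
    (hNA : NoArbitrage T S Q ∨ GeometricNA T S Q ∨ QuantitativeNA T S Q) :
    ∀ t < T,
      (UnivMeasurableSet {ω | GeomAt S Q t ω} ∧ IsFull (priors Q t) {ω | GeomAt S Q t ω} ∧
        ∃ ε : Hist Ω t → ℝ, UnivMeasurable ε ∧ ∀ ω, GeomAt S Q t ω → IsRadius S Q t ω (ε ω)) ∧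
      (UnivMeasurableSet {ω | QuantAt S Q t ω} ∧ IsFull (priors Q t) {ω | QuantAt S Q t ω} ∧
        ∃ β : Hist Ω t → ℝ, UnivMeasurable β ∧
          ∀ ω, QuantAt S Q t ω → IsLossSize S Q t ω (β ω)) := by
  intro t ht
  have hΔ := hS.measurable_increment ht
  have hΔω : ∀ ω, Measurable (increment S t ω) := fun ω => hΔ.comp measurable_prodMk_left
  obtain ⟨f, hf, hfD, hDf⟩ := exists_castaing hΔ (hQ.analytic t ht) (hQ.nonempty t ht)
  have hgeom : ∀ ω, GeomAt S Q t ω ↔ NoHalfSpace (condSupport S Q t ω) := fun ω =>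
    geomAt_iff_noHalfSpace (hfD ω) (hDf ω)
  have hquant : ∀ ω, QuantAt S Q t ω ↔ NoHalfSpace (condSupport S Q t ω) := fun ω =>
    quantAt_iff_noHalfSpace (hΔω ω) (hQ.nonempty t ht ω) (hfD ω) (hDf ω)
  have hdom : ∀ k, UnivMeasurableSet {ω | Dominates (fun n => f n ω) k} := fun k =>
    measurableSet_dominates hf k
  -- `N ω` is the first index `k` with `Dominates (f · ω) k`; both constants are functions of it
  let N : Hist Ω t → ℕ := fun ω => sInf {k | Dominates (fun n => f n ω) k}
  have hN : UnivMeasurable N := by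
    let _ := universalSigma (Hist Ω t)
    exact measurable_to_countable' fun k => measurableSet_sInf_eq hdom k
  have hNdom : ∀ ω, NoHalfSpace (condSupport S Q t ω) → Dominates (fun n => f n ω) (N ω) :=
    fun ω h => Nat.sInf_mem (exists_dominates h (hfD ω) (hDf ω))
  have hmeas : UnivMeasurableSet {ω | NoHalfSpace (condSupport S Q t ω)} := by
    have heq : {ω | NoHalfSpace (condSupport S Q t ω)} =
        ⋃ k, {ω | Dominates (fun n => f n ω) k} := by
      rw [← ofPred_exists]
      exact Set.ext fun ω => noHalfSpace_iff_exists_dominates (hfD ω) (hDf ω)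
    rw [heq]
    exact MeasurableSet.iUnion (m := universalSigma (Hist Ω t)) hdom
  have hfull : IsFull (priors Q t) {ω | NoHalfSpace (condSupport S Q t ω)} := by
    rcases hNA with hNA | hNA | hNA
    · exact hNA.isFull_noHalfSpace hS hQ ht
    · obtain ⟨A, -, hA, hAG⟩ := hNA t ht
      exact hA.mono (compl_subset_compl.2 fun ω hω => (hgeom ω).1 (hAG ω hω))
    · obtain ⟨A, -, hA, hAQ⟩ := hNA t ht
      exact hA.mono (compl_subset_compl.2 fun ω hω => (hquant ω).1 (hAQ ω hω))
  have hpow : ∀ g : ℕ → ℝ, UnivMeasurable fun ω => g (N ω) := fun g =>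
    (measurable_of_countable g).comp_univMeasurable hN
  simp only [hgeom, hquant]
  exact ⟨⟨hmeas, hfull, fun ω => 1 / ((N ω : ℝ) + 1), hpow fun k => 1 / ((k : ℝ) + 1),
      fun ω h => isRadius_of_dominates (hfD ω) (hDf ω) (hNdom ω h)⟩,
    ⟨hmeas, hfull, fun ω => 1 / (4 * ((N ω : ℝ) + 1)), hpow fun k => 1 / (4 * ((k : ℝ) + 1)),
      fun ω h => isLossSize_of_dominates (hΔω ω) (hfD ω) (hDf ω) (hNdom ω h)⟩⟩
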